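/- **Theorem (Hierarchical FPL bound for dynamic learning rates).** Let $\mathcal E$ be a non-empty finite or countably infinite set of experts with complexities $k^i>0$ satisfying $\sum_i e^{-k^i}\le 1$. Let $s_t^i\in[0,1]$ ($t=1,2,\ldots$) be the losses of the experts (a fixed sequence), and write $s_{<t}^i=\sum_{\tau<t}s_\tau^i$, $s_{1:T}^i=\sum_{t=1}^{T}s_t^i$. Let $q^i$ ($i\in\mathcal E$) and $\tilde q^K$ ($K=1,2,\ldots$) be mutually independent random variables, all exponentially distributed with rate $1$. For $K\ge 1$ let $\mathcal E^K=\{i:\lceil k^i\rceil=K\}$. For learning rates $\eta_t^K,\tilde\eta_t>0$ let $$I_t^K=\mathop{\arg\min}_{i\in\mathcal E^K}\Big\{s_{<t}^i+\frac{k^i-q^i}{\eta_t^K}\Big\},\qquad \tilde s_t^K=s_t^{I_t^K},\qquad \tilde I_t=\mathop{\arg\min}_{K:\,\mathcal E^K\neq\emptyset}\Big\{\tilde s_{<t}^K+\frac{\tilde k^K-\tilde q^K}{\tilde\eta_t}\Big\},\qquad \tilde k^K=\tfrac12+2\ln K,$$ with $\tilde s_{<t}^K=\sum_{\tau<t}\tilde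 s_\tau^K$. (The minimisers exist and are unique almost surely.) The hierarchical FPL follows expert $i_t=I_t^{\tilde I_t}$ at time $t$; let $\tilde\ell_{1:T}=E[s_1^{i_1}+\cdots+s_T^{i_T}]$ be its expected loss, over $q$ and $\tilde q$. There is an absolute constant $C>0$ such that the following holds for all such $\mathcal E$, $k$, $s$, all $T\ge 0$ and all experts $i$ (the loss of the hierarchical FPL being integrable). (a) For $\eta_t^K=\sqrt{K/(2t)}$ and $\tilde\eta_t=1/\sqrt t$, $$\tilde\ell_{1:T}\le s_{1:T}^i+2\sqrt{2Tk^i}\,\Big(1+C\,\frac{\ln(2+k^i)}{\sqrt{k^i}}\Big).$$ (b) *Self-confident rates.* Let $\eta_t^K=\sqrt{K/(2(\ell_{<t}^K+1))}$ with $\ell_{<t}^K=E\big[\sum_{\tau<t}s_\tau^{I_\tau^K}\big]$, and $\tilde\eta_t=1/\sqrt{2(\tilde\ell_{<t}+1)}$, where $\tilde\ell_{<t}$ is the expectation of $\sum_{\tau<t}s_\tau^{i_\tau}$, either over $\tilde q$ only (given $q$) or over both $q$ and $\tilde q$. In both cases $$\tilde\ell_{1:T}\le s_{1:T}^i+2\sqrt{2s_{1:T}^ik^i}\,\Big(1+C\,\frac{\ln(2+k^i)}{\sqrt{k^i}}\Big)+C\,(1+k^i).$$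 *Rates based on the best loss so far.* Let $\eta_t^K=\sqrt{1/2}\cdot\min\{1,\sqrt{K/\min_{i\in\mathcal E^K}s_{<t}^i}\}$ (with $K/0=\infty$) and $\tilde\eta_t=1/\min_{K:\,\mathcal E^K\ne\emptyset}\big\{\tilde k^K+\sqrt{(\tilde k^K)^2+2\tilde s_{<t}^K+2}\big\}$. Then $$\tilde\ell_{1:T}\le s_{1:T}^i+2\sqrt{2s_{1:T}^ik^i}\,\Big(1+C\,\frac{\ln(2+k^i)}{\sqrt{k^i}}\Big)+C\,(1+k^i)\ln(2+s_{1:T}^i).$$ In particular the factors are $1+O(\ln k^i/\sqrt{k^i})$ and the additive terms are $O(k^i)$ and $O(k^i\ln s_{1:T}^i)$, respectively, for $k^i,s_{1:T}^i\ge 2$. -/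

import Mathlib

open MeasureTheory

universe u

namespace HFPL

/-- Some minimiser of `f` over `S` (an unspecified element if there is none). In all uses below
the minimiser exists and is unique for almost every perturbation vector. -/
noncomputable def argminOn {α : Type*} [Nonempty α] (S : Set α) (f : α → ℝ) : α :=
  Classical.epsilon fun a => a ∈ S ∧ ∀ b ∈ S, f a ≤ f b

/-- The past loss `s_{<t}` of expert `i`; time steps are `1, 2, 3, …`. -/
noncomputable def pastLoss {α : Type*} (s : ℕ → α → ℝ) (t : ℕ) (i : α) : ℝ :=
  ∑ τ ∈ Finset.Ico 1 t, s τ i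

/-- The total loss `s_{1:T}` of expert `i`. -/
noncomputable def totalLoss {α : Type*} (s : ℕ → α → ℝ) (T : ℕ) (i : α) : ℝ :=
  ∑ t ∈ Finset.Icc 1 T, s t i

/-- The expert which Follow the Perturbed Leader, run on the experts in `S` with complexities `k`,
losses `s`, perturbation `q` and learning rate `η` at time `t`, chooses at time `t`. -/
noncomputable def fplChoice {α : Type*} [Nonempty α] (S : Set α) (k : α → ℝ) (s : ℕ → α → ℝ)
    (η : ℝ) (t : ℕ) (q : α → ℝ) : α :=
  argminOn S fun i => pastLoss s t i + (k i - q i) / η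

/-- The law of a vector of independent exponentially distributed (rate one) perturbations. -/
noncomputable def perturbation (α : Type*) : Measure (α → ℝ) :=
  haveI : IsProbabilityMeasure (ProbabilityTheory.expMeasure 1) :=
    ProbabilityTheory.isProbabilityMeasure_expMeasure one_pos
  Measure.infinitePi fun _ : α => ProbabilityTheory.expMeasure 1

/-- The cumulative expected loss `ℓ_{1:t}` of FPL when the learning rate at each time `t` is the
function `rate` of its own past expected loss `ℓ_{<t}`. -/
noncomputable def selfConfidentLoss {α : Type*} [Nonempty α] (S : Set α) (k : α → ℝ)
    (s : ℕ → α → ℝ) (rate : ℝ → ℝ) : ℕ → ℝ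
  | 0 => 0
  | t + 1 => selfConfidentLoss S k s rate t +
      ∫ q, s (t + 1) (fplChoice S k s (rate (selfConfidentLoss S k s rate t)) (t + 1) q)
        ∂(perturbation α)

section Hierarchy

variable {ι : Type u} [Nonempty ι]

/-- The class of experts `i` with `⌈k i⌉ = K`. -/
def complexityClass (k : ι → ℝ) (K : ℕ) : Set ι := {i | ⌈k i⌉₊ = K}

/-- The indices of the meta experts: the complexity classes which contain an expert. -/
def metaClass (k : ι → ℝ) : Set ℕ := {K | (complexityClass k K).Nonempty}

/-- The complexity `1/2 + 2 ln K` of meta expert `K`. -/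
noncomputable def metaComplexity (K : ℕ) : ℝ := 1 / 2 + 2 * Real.log K

/-- The choice `I_t^K` of FPL on complexity class `K`, with learning rate `η K t`. -/
noncomputable def subChoice (k : ι → ℝ) (s : ℕ → ι → ℝ) (η : ℕ → ℕ → ℝ) (t K : ℕ) (q : ι → ℝ) : ι :=
  fplChoice (complexityClass k K) k s (η K t) t q

/-- The loss suffered by meta expert `K` at time `t`, for a given perturbation `q`. -/
noncomputable def metaLoss (k : ι → ℝ) (s : ℕ → ι → ℝ) (η : ℕ → ℕ → ℝ) (q : ι → ℝ) (t K : ℕ) : ℝ :=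
  s t (subChoice k s η t K q)

/-- The expert chosen by the hierarchical FPL at time `t`, for perturbations `q` of the experts and
`q'` of the meta experts: the meta FPL, whose learning rate `η' t q` may depend on the realised
losses of the meta experts (hence on `q`), picks a class, and FPL on that class picks an expert. -/
noncomputable def hierChoice (k : ι → ℝ) (s : ℕ → ι → ℝ) (η : ℕ → ℕ → ℝ) (η' : ℕ → (ι → ℝ) → ℝ)
    (t : ℕ) (q : ι → ℝ) (q' : ℕ → ℝ) : ι :=
  subChoice k s η t
    (fplChoice (metaClass k) metaComplexity (metaLoss k s η q) (η' t q) t q') q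

/-- The joint law of the two independent perturbation vectors. -/
noncomputable def hierPerturbation (ι : Type u) : Measure ((ι → ℝ) × (ℕ → ℝ)) :=
  (perturbation ι).prod (perturbation ℕ)

/-- The loss accumulated by the hierarchical FPL up to time `T`. -/
noncomputable def hierLoss (k : ι → ℝ) (s : ℕ → ι → ℝ) (η : ℕ → ℕ → ℝ) (η' : ℕ → (ι → ℝ) → ℝ)
    (T : ℕ) (p : (ι → ℝ) × (ℕ → ℝ)) : ℝ :=
  ∑ t ∈ Finset.Icc 1 T, s t (hierChoice k s η η' t p.1 p.2)

/-- The expected loss of the hierarchical FPL up to time `T` is well defined and at most `B`. -/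
def ExpectedLossLE (k : ι → ℝ) (s : ℕ → ι → ℝ) (η : ℕ → ℕ → ℝ) (η' : ℕ → (ι → ℝ) → ℝ)
    (T : ℕ) (B : ℝ) : Prop :=
  Integrable (hierLoss k s η η' T) (hierPerturbation ι) ∧
    ∫ p, hierLoss k s η η' T p ∂(hierPerturbation ι) ≤ B

/-! ### Learning rates depending only on time -/

/-- The rate `√(K / 2t)`. -/
noncomputable def timeRate (K t : ℕ) : ℝ := √((K : ℝ) / (2 * t))

/-- The rate `1 / √t` of the meta FPL. -/
noncomputable def metaTimeRate (t : ℕ) (_q : ι → ℝ) : ℝ := 1 / √(t : ℝ)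

/-! ### Self-confident learning rates -/

/-- The rate `√(K / 2(ℓ_{<t} + 1))`, where `ℓ_{<t}` is the past expected loss of FPL on class `K`
itself. -/
noncomputable def selfConfidentRate (k : ι → ℝ) (s : ℕ → ι → ℝ) (K t : ℕ) : ℝ :=
  √((K : ℝ) / (2 * (selfConfidentLoss (complexityClass k K) k s
    (fun l => √((K : ℝ) / (2 * (l + 1)))) (t - 1) + 1)))

/-- The rate `1 / √(2(ℓ_{<t} + 1))` of the meta FPL, where `ℓ_{<t}` is its past expected loss over
its own perturbation, given the losses of the meta experts (that is, given `q`). -/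
noncomputable def metaSelfConfidentRate (k : ι → ℝ) (s : ℕ → ι → ℝ) (η : ℕ → ℕ → ℝ)
    (t : ℕ) (q : ι → ℝ) : ℝ :=
  1 / √(2 * (selfConfidentLoss (metaClass k) metaComplexity (metaLoss k s η q)
    (fun l => 1 / √(2 * (l + 1))) (t - 1) + 1))

/-- The cumulative expected loss (over both perturbations) of the hierarchical FPL when the meta
learning rate at each time `t` is `1 / √(2(ℓ_{<t} + 1))` for this past expected loss `ℓ_{<t}`. -/
noncomputable def hierSelfConfidentLoss (k : ι → ℝ) (s : ℕ → ι → ℝ) (η : ℕ → ℕ → ℝ) : ℕ → ℝ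
  | 0 => 0
  | t + 1 => hierSelfConfidentLoss k s η t +
      ∫ p, s (t + 1) (hierChoice k s η
        (fun _ _ => 1 / √(2 * (hierSelfConfidentLoss k s η t + 1))) (t + 1) p.1 p.2)
        ∂(hierPerturbation ι)

/-- The rate `1 / √(2(ℓ_{<t} + 1))` of the meta FPL, where `ℓ_{<t}` is its past expected loss over
both perturbations. -/
noncomputable def metaTotalSelfConfidentRate (k : ι → ℝ) (s : ℕ → ι → ℝ) (η : ℕ → ℕ → ℝ)
    (t : ℕ) (_q : ι → ℝ) : ℝ :=
  1 / √(2 * (hierSelfConfidentLoss k s η (t - 1) + 1))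

/-! ### Learning rates depending on the best loss so far -/

/-- The best past loss in complexity class `K`. -/
noncomputable def minPastLoss (k : ι → ℝ) (s : ℕ → ι → ℝ) (K t : ℕ) : ℝ :=
  ⨅ i : complexityClass k K, pastLoss s t (i : ι)

/-- The rate `√(1/2) · min {1, √(K / s_{<t}^min)}`, where the quotient is `∞` if the denominator
is zero. -/
noncomputable def minLossRate (k : ι → ℝ) (s : ℕ → ι → ℝ) (K t : ℕ) : ℝ :=
  open Classical in
  √(1 / 2) * (if minPastLoss k s K t = 0 then 1 else min 1 (√((K : ℝ) / minPastLoss k s K t)))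

/-- The rate `1 / min_K {k^K + √((k^K)² + 2 s_{<t}^K + 2)}` of the meta FPL, with the complexities
and (realised) losses of the meta experts. -/
noncomputable def metaMinLossRate (k : ι → ℝ) (s : ℕ → ι → ℝ) (η : ℕ → ℕ → ℝ)
    (t : ℕ) (q : ι → ℝ) : ℝ :=
  1 / ⨅ K : metaClass k, (metaComplexity K +
    √(metaComplexity K ^ 2 + 2 * pastLoss (metaLoss k s η q) t (K : ℕ) + 2))

end Hierarchy

end HFPL

namespace HFPL

open ProbabilityTheory ENNReal

/-! The core is a regret bound for one FPL with nonincreasing rates `η t`, proved by comparison with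
an infeasible FPL that already knows the losses of the current step. By the be-the-leader induction
(`sum_leader_le`), the infeasible FPL exceeds expert `i` by at most `(k i - q i + B) / η T`, where
`B` dominates all `q j - k j`. Taking for `B` the sum of their positive parts gives mean at most `∑
exp (-k j) ≤ 1`, which cancels the mean of `q i`; hence `sum_infeasibleLoss_le`, with excess `k i /
η T`. The feasible FPL loses at most `exp η` times as much per step (`expLoss_le_infeasibleLoss`):
lowering one exponential coordinate by `η` costs a factor `exp η` in probability and offsets one
step of losses in `[0, 1]`.

With a rate `a / √(t or past loss + 1)` these two errors add up to about `(k / a + 2 a) √(T or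
loss)`. The past-loss form is recursive and is resolved through a quadratic inequality. For rates
based on a best past loss, summation by parts against a potential (`sum_mul_le_of_potential`) gives
the class bound; the meta rate is instead shown to be self-confident with respect to the infeasible
loss (`sum_expLoss_tradeoff_le`).

Within the class `⌈k i⌉ = K` all complexities are at most `K ≤ k i + 1`, so `a = √(K / 2)` gives the
leading term `2 √(2 K ·)`. Given `q`, the class losses form a fixed sequence in `[0, 1]`, because
the meta perturbation is independent of `q`; the same regret bound therefore applies to the meta
FPL, whose complexities `1/2 + 2 log K` satisfy Kraft's inequality (`tsum_metaClass_le`). It adds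
only `O(log K)` times a square root. Integrating over `q` uses Fubini and, for most rates, concavity
of the square root (`integral_le_add_mul_sqrt`). When the meta rate uses the total expectation, the
recursion is closed only after averaging. `time_bound` and `loss_bound` turn the sum of errors into
the stated form. -/

instance isProbabilityMeasure_expMeasure_one : IsProbabilityMeasure (expMeasure 1) :=
  isProbabilityMeasure_expMeasure one_pos

instance isProbabilityMeasure_perturbation (α : Type*) :
    IsProbabilityMeasure (perturbation α) := by
  unfold perturbation; infer_instance

/-! ### The exponential law: translates, tails and first moments. -/

lemma expMeasure_one_eq : expMeasure 1 = volume.withDensity (exponentialPDF 1) := rfl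

lemma measurable_exponentialPDF_one : Measurable (exponentialPDF 1) :=
  (measurable_exponentialPDFReal 1).ennreal_ofReal

lemma exponentialPDF_add_ge {h : ℝ} (hh : 0 ≤ h) (x : ℝ) :
    ENNReal.ofReal (Real.exp (-h)) * exponentialPDF 1 x ≤ exponentialPDF 1 (x + h) := by
  rcases lt_or_ge x 0 with hx | hx
  · simp [exponentialPDF_of_neg hx]
  · rw [exponentialPDF_of_nonneg hx, exponentialPDF_of_nonneg (by linarith),
      ← ENNReal.ofReal_mul (Real.exp_pos _).le]
    rw [one_mul, one_mul, one_mul, one_mul, ← Real.exp_add, neg_add_rev]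

/-- The sign of `h` is free here: for `x + h < 0` the left side vanishes, otherwise equality holds.
This yields tail bounds valid for negative thresholds too. -/
lemma exponentialPDF_add_le {h x : ℝ} (hx : 0 ≤ x) :
    exponentialPDF 1 (x + h) ≤ ENNReal.ofReal (Real.exp (-h)) * exponentialPDF 1 x := by
  rcases lt_or_ge (x + h) 0 with hxh | hxh
  · simp [exponentialPDF_of_neg hxh]
  · rw [exponentialPDF_of_nonneg hx, exponentialPDF_of_nonneg hxh,
      ← ENNReal.ofReal_mul (Real.exp_pos _).le]
    rw [one_mul, one_mul, one_mul, one_mul, ← Real.exp_add, neg_add_rev]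

lemma lintegral_expMeasure_one {f : ℝ → ℝ≥0∞} (hf : Measurable f) (h : ℝ) :
    ∫⁻ x, f x ∂(expMeasure 1) = ∫⁻ x, exponentialPDF 1 (x + h) * f (x + h) := by
  rw [expMeasure_one_eq, lintegral_withDensity_eq_lintegral_mul _ measurable_exponentialPDF_one hf,
    ← lintegral_add_right_eq_self _ h]
  rfl

/-- The exponential distribution is dominated, up to a factor `exp h`, by its translates. -/
lemma expMeasure_le_shift {h : ℝ} (hh : 0 ≤ h) {U : Set ℝ} (hU : MeasurableSet U) :
    ENNReal.ofReal (Real.exp (-h)) * expMeasure 1 U ≤ expMeasure 1 ((fun x => x - h) ⁻¹' U) := by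
  have hm : MeasurableSet ((fun x : ℝ => x - h) ⁻¹' U) := (measurable_id.sub_const h) hU
  rw [← lintegral_indicator_one hU, ← lintegral_indicator_one hm,
    lintegral_expMeasure_one (measurable_one.indicator hU) 0,
    lintegral_expMeasure_one (measurable_one.indicator hm) h,
    ← lintegral_const_mul]
  · refine lintegral_mono fun x => ?_
    by_cases hx : x ∈ U
    · simpa [Set.indicator, hx] using exponentialPDF_add_ge hh x
    · simp [Set.indicator, hx]
  · simp only [add_zero]
    exact measurable_exponentialPDF_one.mul (measurable_one.indicator hU)

lemma expMeasure_Ici_le (a : ℝ) :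
    expMeasure 1 (Set.Ici a) ≤ ENNReal.ofReal (Real.exp (-a)) := by
  rw [← lintegral_indicator_one measurableSet_Ici,
    lintegral_expMeasure_one (measurable_one.indicator measurableSet_Ici) a]
  calc _ ≤ ∫⁻ x, ENNReal.ofReal (Real.exp (-a)) * exponentialPDF 1 x := by
        refine lintegral_mono fun x => ?_
        by_cases hx : 0 ≤ x
        · simpa [Set.indicator, hx] using exponentialPDF_add_le hx
        · simp [Set.indicator, hx]
    _ = _ := by
        rw [lintegral_const_mul _ measurable_exponentialPDF_one,
          lintegral_exponentialPDF_eq_one one_pos, mul_one]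

/-- `x exp (-x)` is the density of a Gamma law, so first moments reduce to its total mass being one.
-/
lemma exponentialPDF_mul_ofReal (x : ℝ) :
    exponentialPDF 1 x * ENNReal.ofReal x = gammaPDF 2 1 x := by
  rcases lt_or_ge x 0 with hx | hx
  · simp [exponentialPDF_of_neg hx, gammaPDF_of_neg hx]
  · rw [exponentialPDF_of_nonneg hx, gammaPDF_of_nonneg hx, ← ENNReal.ofReal_mul (by positivity)]
    congr 1
    have : Real.Gamma 2 = 1 := by
      have := Real.Gamma_nat_eq_factorial 1
      norm_num at this ⊢
    norm_num [this]
    ring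

lemma lintegral_ofReal_expMeasure : ∫⁻ x, ENNReal.ofReal x ∂(expMeasure 1) = 1 := by
  rw [lintegral_expMeasure_one ENNReal.measurable_ofReal 0]
  simp_rw [add_zero, exponentialPDF_mul_ofReal]
  exact lintegral_gammaPDF_eq_one two_pos one_pos

lemma lintegral_ofReal_sub_expMeasure_le (a : ℝ) :
    ∫⁻ x, ENNReal.ofReal (x - a) ∂(expMeasure 1) ≤ ENNReal.ofReal (Real.exp (-a)) := by
  rw [lintegral_expMeasure_one (by fun_prop) a]
  calc _ ≤ ∫⁻ x, ENNReal.ofReal (Real.exp (-a)) * gammaPDF 2 1 x := by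
        refine lintegral_mono fun x => ?_
        rw [← exponentialPDF_mul_ofReal, add_sub_cancel_right, ← mul_assoc]
        rcases le_or_gt x 0 with hx | hx
        · simp [ENNReal.ofReal_of_nonpos hx]
        · gcongr
          exact exponentialPDF_add_le hx.le
    _ = _ := by
        rw [lintegral_const_mul' _ _ ENNReal.ofReal_ne_top,
          lintegral_gammaPDF_eq_one two_pos one_pos, mul_one]

lemma ae_nonneg_expMeasure : ∀ᵐ x ∂(expMeasure 1), 0 ≤ x := by
  have hm : MeasurableSet {x : ℝ | ¬ 0 ≤ x} := by
    simpa [Set.Iio] using (measurableSet_Iio : MeasurableSet (Set.Iio (0 : ℝ)))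
  rw [ae_iff, ← lintegral_indicator_one hm,
    lintegral_expMeasure_one (measurable_one.indicator hm) 0]
  simp only [add_zero]
  refine (lintegral_eq_zero_iff
    (measurable_exponentialPDF_one.mul (measurable_one.indicator hm))).2 (.of_forall fun x => ?_)
  by_cases hx : 0 ≤ x
  · simp [Set.indicator, hx]
  · simp [exponentialPDF_of_neg (not_le.1 hx)]

lemma expMeasure_singleton (a : ℝ) : expMeasure 1 {a} = 0 :=
  withDensity_absolutelyContinuous _ _ Real.volume_singleton

/-! ### The product law, studied by resampling or shifting a single coordinate. -/

variable {α : Type*}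

lemma measurePreserving_eval (i : α) :
    MeasurePreserving (Function.eval i) (perturbation α) (expMeasure 1) :=
  measurePreserving_eval_infinitePi _ i

lemma measurable_update_prod [DecidableEq α] (i : α) :
    Measurable fun p : (α → ℝ) × ℝ => Function.update p.1 i p.2 :=
  measurable_pi_iff.2 fun j => by
    by_cases h : j = i
    · subst h; simpa using measurable_snd
    · simp only [Function.update_of_ne h]
      fun_prop

/-- Resampling one coordinate does not change the law of the perturbation. -/
lemma map_update_perturbation [DecidableEq α] (i : α) :
    ((perturbation α).prod (expMeasure 1)).map (fun p => Function.update p.1 i p.2) =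
      perturbation α := by
  refine Measure.eq_infinitePi _ fun s t ht => ?_
  rw [Measure.map_apply (measurable_update_prod i) (MeasurableSet.pi s.countable_toSet fun j _ => ht j)]
  by_cases hi : i ∈ s
  · have : (fun p : (α → ℝ) × ℝ => Function.update p.1 i p.2) ⁻¹' (Set.pi s t) =
        (Set.pi (s.erase i : Finset α) t) ×ˢ t i := by
      ext p
      simp only [Set.mem_preimage, Set.mem_pi, Finset.mem_coe, Set.mem_prod, Finset.mem_erase]
      constructor
      · intro h
        refine ⟨fun j hj => ?_, by simpa using h i hi⟩
        simpa [Function.update_of_ne hj.1] using h j hj.2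
      · rintro ⟨h1, h2⟩ j hj
        by_cases hji : j = i
        · subst hji; simpa using h2
        · simpa [Function.update_of_ne hji] using h1 j ⟨hji, hj⟩
    rw [this, Measure.prod_prod, perturbation, Measure.infinitePi_pi _ (fun j _ => ht j),
      Finset.prod_erase_mul s (fun j => expMeasure 1 (t j)) hi]
  · have : (fun p : (α → ℝ) × ℝ => Function.update p.1 i p.2) ⁻¹' (Set.pi s t) =
        (Set.pi s t) ×ˢ Set.univ := by
      ext p
      simp only [Set.mem_preimage, Set.mem_pi, Finset.mem_coe, Set.mem_prod, Set.mem_univ, and_true]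
      refine forall₂_congr fun j hj => ?_
      rw [Function.update_of_ne (by rintro rfl; exact hi hj)]
    rw [this, Measure.prod_prod, perturbation, Measure.infinitePi_pi _ (fun j _ => ht j),
      measure_univ, mul_one]

lemma perturbation_apply_update [DecidableEq α] (i : α) {A : Set (α → ℝ)} (hA : MeasurableSet A) :
    perturbation α A = ∫⁻ q, expMeasure 1 {x | Function.update q i x ∈ A} ∂(perturbation α) := by
  conv_lhs => rw [← map_update_perturbation i]
  rw [Measure.map_apply (measurable_update_prod i) hA,
    Measure.prod_apply (measurable_update_prod i hA)]
  rfl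

/-- The law of the perturbation is dominated, up to a factor `exp h`, by its translates in one
coordinate. -/
lemma perturbation_le_shift [DecidableEq α] (i : α) {h : ℝ} (hh : 0 ≤ h) {A : Set (α → ℝ)}
    (hA : MeasurableSet A) :
    ENNReal.ofReal (Real.exp (-h)) * perturbation α A ≤
      perturbation α {q | Function.update q i (q i - h) ∈ A} := by
  have hm : Measurable fun q : α → ℝ => Function.update q i (q i - h) :=
    by
    exact (measurable_update_prod i).comp
      (measurable_id.prodMk ((measurable_pi_apply i).sub_const h))
  have hm' : MeasurableSet {q : α → ℝ | Function.update q i (q i - h) ∈ A} := hm hA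
  rw [perturbation_apply_update i hA, perturbation_apply_update i hm',
    ← lintegral_const_mul' _ _ ENNReal.ofReal_ne_top]
  refine lintegral_mono fun q => ?_
  have hU : MeasurableSet {x | Function.update q i x ∈ A} :=
    ((measurable_update_prod i).comp (measurable_const.prodMk measurable_id)) hA
  refine (expMeasure_le_shift hh hU).trans (measure_mono fun x hx => ?_)
  simpa using hx

/-- Once all coordinates but `i` are frozen, the event pins `q i` to a single point, and the
exponential law has no atoms. This excludes ties between experts. -/
lemma ae_sub_ne {i j : α} (hij : i ≠ j) (c : ℝ) : ∀ᵐ q ∂(perturbation α), q i - q j ≠ c := by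
  classical
  have hm : MeasurableSet {q : α → ℝ | q i - q j = c} :=
    measurableSet_eq_fun ((measurable_pi_apply i).sub (measurable_pi_apply j)) measurable_const
  rw [ae_iff]
  simp only [ne_eq, not_not]
  rw [perturbation_apply_update i hm]
  have h (q : α → ℝ) : {x : ℝ | Function.update q i x ∈ {q : α → ℝ | q i - q j = c}} =
      {c + q j} := by
    ext x; simp [Function.update_of_ne hij.symm, sub_eq_iff_eq_add]
  simp_rw [h, expMeasure_singleton, lintegral_zero]

lemma integrable_perturbation_apply (i : α) :
    Integrable (fun q : α → ℝ => q i) (perturbation α) := by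
  have : Integrable (fun x : ℝ => x) (expMeasure 1) := by
    refine ⟨measurable_id.aestronglyMeasurable, ?_⟩
    rw [hasFiniteIntegral_iff_ofReal ae_nonneg_expMeasure, lintegral_ofReal_expMeasure]
    simp
  exact (measurePreserving_eval i).integrable_comp_of_integrable this

lemma integral_perturbation_apply (i : α) : ∫ q, q i ∂(perturbation α) = 1 := by
  have h0 : ∀ᵐ q ∂(perturbation α), 0 ≤ q i :=
    (measurePreserving_eval i).quasiMeasurePreserving.ae ae_nonneg_expMeasure
  rw [integral_eq_lintegral_of_nonneg_ae h0 (measurable_pi_apply i).aestronglyMeasurable]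
  have := (measurePreserving_eval i).lintegral_comp
    (f := fun x => ENNReal.ofReal x) ENNReal.measurable_ofReal
  simp only [Function.eval] at this
  rw [this, lintegral_ofReal_expMeasure]; rfl

lemma lintegral_ofReal_perturbation_sub_le (i : α) (a : ℝ) :
    ∫⁻ q, ENNReal.ofReal (q i - a) ∂(perturbation α) ≤ ENNReal.ofReal (Real.exp (-a)) := by
  have := (measurePreserving_eval i).lintegral_comp
    (f := fun x => ENNReal.ofReal (x - a)) (by fun_prop)
  simp only [Function.eval] at this
  rw [this]; exact lintegral_ofReal_sub_expMeasure_le a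

lemma perturbation_ge_le (i : α) (a : ℝ) :
    perturbation α {q | a ≤ q i} ≤ ENNReal.ofReal (Real.exp (-a)) := by
  have := (measurePreserving_eval i).measure_preimage (measurableSet_Ici (a := a)).nullMeasurableSet
  exact this.le.trans (expMeasure_Ici_le a)

/-- `i` is the unique minimiser of `f` over `S`. -/
def StrictArgmin {α : Type*} (S : Set α) (f : α → ℝ) (i : α) : Prop :=
  i ∈ S ∧ ∀ j ∈ S, j ≠ i → f i < f j

/-! ### Unique minimisers. -/

section Argmin

variable {α : Type*} {S : Set α} {f : α → ℝ} {i : α}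

lemma StrictArgmin.le (h : StrictArgmin S f i) {j : α} (hj : j ∈ S) : f i ≤ f j := by
  by_cases hji : j = i
  · rw [hji]
  · exact (h.2 j hj hji).le

lemma StrictArgmin.eq {j : α} (h : StrictArgmin S f i) (h' : StrictArgmin S f j) : i = j := by
  by_contra hij
  exact lt_asymm (h.2 j h'.1 (Ne.symm hij)) (h'.2 i h.1 hij)

lemma StrictArgmin.argminOn_eq [Nonempty α] (h : StrictArgmin S f i) : argminOn S f = i := by
  have hex : ∃ a, a ∈ S ∧ ∀ b ∈ S, f a ≤ f b := ⟨i, h.1, fun b hb => h.le hb⟩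
  obtain ⟨h1, h2⟩ := Classical.epsilon_spec hex
  by_contra hne
  exact absurd (h.2 _ h1 hne) (not_lt.2 (h2 i h.1))

lemma exists_strictArgmin (hS : S.Nonempty) (hfin : ∀ c, {j | j ∈ S ∧ f j ≤ c}.Finite)
    (hinj : ∀ i j, i ≠ j → f i ≠ f j) : ∃ i, StrictArgmin S f i := by
  obtain ⟨a, ha⟩ := hS
  obtain ⟨i, hi, hmin⟩ := (hfin (f a)).exists_minimalFor f _ ⟨a, ha, le_rfl⟩
  refine ⟨i, hi.1, fun j hj hji => lt_of_le_of_ne ?_ (hinj _ _ (Ne.symm hji))⟩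
  by_contra hlt
  push Not at hlt
  exact absurd (hmin ⟨hj, hlt.le.trans hi.2⟩ hlt.le) (not_le.2 hlt)

end Argmin

/-! ### Measurability of random minimisers and of evaluation at a random index. -/

section Measurability

variable {α Ω : Type*} [Countable α] [MeasurableSpace Ω] {μ : Measure Ω}

lemma nullMeasurableSet_strictArgmin {S : Set α} {g : Ω → α → ℝ}
    (hg : ∀ i, AEMeasurable (fun ω => g ω i) μ) (i : α) :
    NullMeasurableSet {ω | StrictArgmin S (g ω) i} μ := by
  by_cases hi : i ∈ S
  · have : {ω | StrictArgmin S (g ω) i} = ⋂ j : α, {ω | j ∈ S → j ≠ i → g ω i < g ω j} := by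
      ext ω; simp [StrictArgmin, hi]
    rw [this]
    refine .iInter fun j => ?_
    by_cases hj : j ∈ S ∧ j ≠ i
    · simpa [hj.1, hj.2] using nullMeasurableSet_lt (hg i) (hg j)
    · have : {ω | j ∈ S → j ≠ i → g ω i < g ω j} = Set.univ := by
        ext ω; simp only [Set.mem_ofPred_eq, Set.mem_univ, iff_true]
        exact fun h1 h2 => absurd ⟨h1, h2⟩ hj
      rw [this]; exact .univ
  · simp [StrictArgmin, hi]

omit [Countable α] in
-- `argminOn` is an arbitrary choice where no minimiser exists or ties occur, so its level sets are
-- controlled only up to null sets. This is why null measurability is used for choices from here on.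
lemma argminOn_ae_eq [Nonempty α] {S : Set α} {g : Ω → α → ℝ}
    (h : ∀ᵐ ω ∂μ, ∃ i, StrictArgmin S (g ω) i) (i : α) :
    {ω | argminOn S (g ω) = i} =ᵐ[μ] {ω | StrictArgmin S (g ω) i} := by
  filter_upwards [h] with ω ⟨j, hj⟩
  apply propext
  change argminOn S (g ω) = i ↔ StrictArgmin S (g ω) i
  rw [hj.argminOn_eq]
  exact ⟨fun h => h ▸ hj, fun h => hj.eq h⟩

lemma nullMeasurableSet_argminOn [Nonempty α] {S : Set α} {g : Ω → α → ℝ}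
    (hg : ∀ i, AEMeasurable (fun ω => g ω i) μ)
    (h : ∀ᵐ ω ∂μ, ∃ i, StrictArgmin S (g ω) i) (i : α) :
    NullMeasurableSet {ω | argminOn S (g ω) = i} μ :=
  (nullMeasurableSet_strictArgmin hg i).congr (argminOn_ae_eq h i).symm

/-- Evaluating a countable family of measurable functions at a measurably chosen index. -/
lemma aemeasurable_apply_choice {c : Ω → α} (hc : ∀ i, NullMeasurableSet {ω | c ω = i} μ)
    {g : α → Ω → ℝ} (hg : ∀ i, AEMeasurable (g i) μ) :
    AEMeasurable (fun ω => g (c ω) ω) μ := by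
  have hU : ⋃ i, {ω | c ω = i} = Set.univ := by ext; simp
  rw [← Measure.restrict_univ (μ := μ), ← hU, aemeasurable_iUnion_iff]
  intro i
  refine (hg i).restrict.congr ?_
  filter_upwards [ae_restrict_mem₀ (hc i)] with ω hω
  rw [show c ω = i from hω]

lemma lintegral_apply_choice {c : Ω → α} (hc : ∀ i, NullMeasurableSet {ω | c ω = i} μ)
    (v : α → ℝ≥0∞) : ∫⁻ ω, v (c ω) ∂μ = ∑' i, v i * μ {ω | c ω = i} := by
  have hU : ⋃ i, {ω | c ω = i} = Set.univ := by ext; simp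
  rw [← setLIntegral_univ, ← hU, lintegral_iUnion₀ hc]
  · refine tsum_congr fun i => ?_
    rw [← setLIntegral_const]
    refine lintegral_congr_ae ?_
    filter_upwards [ae_restrict_mem₀ (hc i)] with ω hω
    rw [show c ω = i from hω]
  · intro i j hij
    refine (Set.disjoint_left.2 fun ω h1 h2 => hij ?_).aedisjoint
    exact h1.symm.trans h2

/-- Unique minimisers exist almost surely for a product measure if they do so on almost every
section. -/
lemma ae_prod_exists_strictArgmin {β : Type*} [MeasurableSpace β] {ν : Measure β} [SFinite ν]
    {S : Set α} {g : Ω × β → α → ℝ} (hg : ∀ i, AEMeasurable (fun p => g p i) (μ.prod ν))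
    (h : ∀ᵐ ω ∂μ, ∀ᵐ x ∂ν, ∃ i, StrictArgmin S (g (ω, x)) i) :
    ∀ᵐ p ∂(μ.prod ν), ∃ i, StrictArgmin S (g p) i := by
  have hm : NullMeasurableSet {p | ∃ i, StrictArgmin S (g p) i} (μ.prod ν) := by
    have : {p | ∃ i, StrictArgmin S (g p) i} = ⋃ i, {p | StrictArgmin S (g p) i} := by ext; simp
    rw [this]
    exact .iUnion fun i => nullMeasurableSet_strictArgmin hg i
  -- `Measure.measure_prod_null_of_ae_null` is applied to a measurable representative of the
  -- exceptional set.
  obtain ⟨A, hAm, hA⟩ := hm.compl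
  have hA0 : (μ.prod ν) A = 0 := by
    refine Measure.measure_prod_null_of_ae_null hAm ?_
    have h1 := Measure.ae_ae_of_ae_prod (Filter.eventuallyEq_set.1 hA)
    filter_upwards [h, h1] with ω h2 h3
    rw [Pi.zero_apply, measure_eq_zero_iff_ae_notMem]
    filter_upwards [h2, h3] with x h4 h5 h6
    exact h5.2 h6 h4
  rw [ae_iff]
  exact (measure_congr hA).trans hA0

end Measurability

/-! ### Almost sure existence and uniqueness of the perturbed leader. -/

section Perturbation

variable {α : Type*} [Countable α] {S : Set α} {k : α → ℝ}

/-- Borel–Cantelli: `q i ≥ k i - n` has probability at most `exp n * exp (-k i)`, which is summable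
over `S`. -/
lemma ae_finite_sub_le (hk : ∑' i : S, ENNReal.ofReal (Real.exp (-k i)) ≠ ∞) :
    ∀ᵐ q ∂(perturbation α), ∀ c : ℝ, {i | i ∈ S ∧ k i - q i ≤ c}.Finite := by
  have h (n : ℕ) : ∀ᵐ q ∂(perturbation α), {i : S | q ∈ {q : α → ℝ | k i - n ≤ q i}}.Finite := by
    refine ae_finite_setOfPred_mem (ne_top_of_le_ne_top ?_ (ENNReal.tsum_le_tsum fun i : S =>
      perturbation_ge_le (i : α) (k i - n)))
    have (i : S) : ENNReal.ofReal (Real.exp (-(k i - n))) =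
        ENNReal.ofReal (Real.exp n) * ENNReal.ofReal (Real.exp (-k i)) := by
      rw [← ENNReal.ofReal_mul (Real.exp_pos _).le, ← Real.exp_add]; congr 2; ring
    simp_rw [this, ENNReal.tsum_mul_left]
    exact ENNReal.mul_ne_top ENNReal.ofReal_ne_top hk
  filter_upwards [ae_all_iff.2 h] with q hq c
  obtain ⟨n, hn⟩ := exists_nat_ge c
  refine ((hq n).image Subtype.val).subset fun i hi => ⟨⟨i, hi.1⟩, ?_, rfl⟩
  have := hi.2
  simp only [Set.mem_ofPred_eq]
  linarith

/-- As `b ≥ 0`, sublevel sets lie in those of `k i - q i`, which are finite, so a minimum is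
attained. A tie between `i` and `j` prescribes the value of `q i - q j`; countably many pairs leave
a null set. -/
lemma ae_exists_strictArgmin (hS : S.Nonempty)
    (hk : ∑' i : S, ENNReal.ofReal (Real.exp (-k i)) ≠ ∞) {b : α → ℝ} (hb : ∀ i, 0 ≤ b i)
    {η : ℝ} (hη : 0 < η) :
    ∀ᵐ q ∂(perturbation α), ∃ i, StrictArgmin S (fun i => b i + (k i - q i) / η) i := by
  have hne : ∀ᵐ q ∂(perturbation α), ∀ i j : α, i ≠ j →
      q i - q j ≠ k i - k j + η * (b i - b j) := by
    rw [ae_all_iff]; intro i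
    rw [ae_all_iff]; intro j
    by_cases hij : i = j
    · simp [hij]
    · filter_upwards [ae_sub_ne hij (k i - k j + η * (b i - b j))] with q hq _ using hq
  filter_upwards [hne, ae_finite_sub_le hk] with q h1 h2
  refine exists_strictArgmin hS (fun c => (h2 (c * η)).subset fun i hi => ⟨hi.1, ?_⟩) ?_
  · have h3 : b i + (k i - q i) / η ≤ c := hi.2
    rw [← div_le_iff₀ hη]
    linarith [hb i]
  · intro i j hij h
    refine h1 i j hij ?_
    field_simp at h
    linarith

end Perturbation

/-! ### Measurability of the FPL choice. -/

section FplChoice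

variable {α : Type*} [Countable α] [Nonempty α] {S : Set α} {k : α → ℝ}

lemma pastLoss_nonneg {β : Type*} {s : ℕ → β → ℝ} (hs : ∀ t, 1 ≤ t → ∀ i, 0 ≤ s t i) (t : ℕ)
    (i : β) : 0 ≤ pastLoss s t i :=
  Finset.sum_nonneg fun τ hτ => hs τ (Finset.mem_Ico.1 hτ).1 i

lemma nullMeasurableSet_fplChoice (hS : S.Nonempty)
    (hk : ∑' i : S, ENNReal.ofReal (Real.exp (-k i)) ≠ ∞) {s : ℕ → α → ℝ}
    (hs : ∀ t, 1 ≤ t → ∀ i, 0 ≤ s t i) {η : ℝ} (hη : 0 < η) (t : ℕ) (i : α) :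
    NullMeasurableSet {q | fplChoice S k s η t q = i} (perturbation α) := by
  have hg (i : α) : AEMeasurable (fun q : α → ℝ => pastLoss s t i + (k i - q i) / η)
      (perturbation α) :=
    ((((measurable_pi_apply i).const_sub _).div_const _).const_add _).aemeasurable
  have h := ae_exists_strictArgmin hS hk (pastLoss_nonneg hs t) hη
  have h2 := nullMeasurableSet_argminOn hg h i
  exact h2

/-- Joint measurability of the choice of FPL when losses and rate are random, but independent of
the perturbation. -/
lemma nullMeasurableSet_fplChoice_prod {Ω : Type*} [MeasurableSpace Ω] {μ : Measure Ω} [SFinite μ]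
    (hS : S.Nonempty) (hk : ∑' i : S, ENNReal.ofReal (Real.exp (-k i)) ≠ ∞)
    {s : Ω → ℕ → α → ℝ} (hs : ∀ ω, ∀ t, 1 ≤ t → ∀ i, 0 ≤ s ω t i)
    (hsm : ∀ t, 1 ≤ t → ∀ i, AEMeasurable (fun ω => s ω t i) μ)
    {η : Ω → ℝ} (hη : ∀ ω, 0 < η ω) (hηm : AEMeasurable η μ) (t : ℕ) (i : α) :
    NullMeasurableSet {p : Ω × (α → ℝ) | fplChoice S k (s p.1) (η p.1) t p.2 = i}
      (μ.prod (perturbation α)) := by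
  have hg (i : α) : AEMeasurable (fun p : Ω × (α → ℝ) =>
      pastLoss (s p.1) t i + (k i - p.2 i) / η p.1) (μ.prod (perturbation α)) := by
    have h1 : AEMeasurable (fun ω => pastLoss (s ω) t i) μ :=
      Finset.aemeasurable_fun_sum _ fun τ hτ => hsm τ (Finset.mem_Ico.1 hτ).1 i
    have h2 : AEMeasurable (fun p : Ω × (α → ℝ) => p.2 i) (μ.prod (perturbation α)) := by fun_prop
    exact h1.comp_fst.add ((h2.const_sub _).div hηm.comp_fst)
  exact nullMeasurableSet_argminOn
    (g := fun (p : Ω × (α → ℝ)) i => pastLoss (s p.1) t i + (k i - p.2 i) / η p.1) hg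
    (ae_prod_exists_strictArgmin hg (.of_forall fun ω =>
      ae_exists_strictArgmin hS hk (pastLoss_nonneg (hs ω) t) (hη ω))) i

end FplChoice

/-- The expected loss at time `t` of FPL on the experts in `S`, with learning rate `η`. -/
noncomputable def expLoss {α : Type*} [Nonempty α] (S : Set α) (k : α → ℝ) (s : ℕ → α → ℝ)
    (η : ℝ) (t : ℕ) : ℝ :=
  ∫ q, s t (fplChoice S k s η t q) ∂(perturbation α)

/-- The expected loss at time `t` of the infeasible FPL on the experts in `S`, which also knows the
losses at time `t`. -/
noncomputable def infeasibleLoss {α : Type*} [Nonempty α] (S : Set α) (k : α → ℝ) (s : ℕ → α → ℝ)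
    (η : ℝ) (t : ℕ) : ℝ :=
  ∫ q, s t (fplChoice S k s η (t + 1) q) ∂(perturbation α)

lemma pastLoss_succ {α : Type*} (s : ℕ → α → ℝ) {t : ℕ} (ht : 1 ≤ t) (i : α) :
    pastLoss s (t + 1) i = pastLoss s t i + s t i :=
  Finset.sum_Ico_succ_top ht _

lemma pastLoss_one {α : Type*} (s : ℕ → α → ℝ) (i : α) : pastLoss s 1 i = 0 := by
  simp [pastLoss]

lemma pastLoss_add_one {α : Type*} (s : ℕ → α → ℝ) (T : ℕ) (i : α) :
    pastLoss s (T + 1) i = totalLoss s T i := rfl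

lemma perturbation_le_shift₀ {α : Type*} [DecidableEq α] (i : α) {h : ℝ} (hh : 0 ≤ h)
    {A : Set (α → ℝ)} (hA : NullMeasurableSet A (perturbation α)) :
    ENNReal.ofReal (Real.exp (-h)) * perturbation α A ≤
      perturbation α {q | Function.update q i (q i - h) ∈ A} := by
  obtain ⟨B, hBA, hB, hBe⟩ := hA.exists_measurable_subset_ae_eq
  rw [← measure_congr hBe]
  exact (perturbation_le_shift i hh hB).trans (measure_mono fun q hq => hBA hq)

/-! ### Regret of one FPL through the infeasible FPL. -/

section Generic

variable {α : Type*} [Nonempty α] {S : Set α} {k : α → ℝ} {s : ℕ → α → ℝ}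

omit [Nonempty α] in
/-- Be the leader: the perturbed leader with one step of lookahead suffers hardly more loss than any
expert. -/
lemma sum_leader_le {η : ℕ → ℝ} (hη : ∀ t, 1 ≤ t → 0 < η t)
    (hanti : ∀ t, 1 ≤ t → η (t + 1) ≤ η t) {q : α → ℝ} {B : ℝ} (hB : ∀ i ∈ S, q i - k i ≤ B)
    {J : ℕ → α} {T : ℕ} (hT : 1 ≤ T)
    (hJ : ∀ t ∈ Finset.Icc 1 T,
      StrictArgmin S (fun i => pastLoss s (t + 1) i + (k i - q i) / η t) (J t))
    {i : α} (hi : i ∈ S) :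
    ∑ t ∈ Finset.Icc 1 T, s t (J t) ≤ totalLoss s T i + (k i - q i + B) / η T := by
  induction T, hT using Nat.le_induction generalizing i with
  | base =>
    have h1 := hJ 1 (by simp)
    have h2 := h1.le hi
    have h3 : 0 ≤ (k (J 1) - q (J 1) + B) / η 1 :=
      div_nonneg (by linarith [hB _ h1.1]) (hη 1 le_rfl).le
    simp only [pastLoss_succ s le_rfl, pastLoss_one, zero_add] at h2
    simp only [totalLoss, Finset.Icc_self, Finset.sum_singleton]
    rw [add_div] at h3 ⊢
    linarith
  | succ n hn ih =>
    have h1 := hJ (n + 1) (Finset.mem_Icc.2 ⟨by omega, le_rfl⟩)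
    have h2 := h1.le hi
    -- The comparator in the induction hypothesis is the new leader `J (n + 1)`, not `i`; hence the
    -- generalisation over `i`.
    have h3 := ih (fun t ht => hJ t (Finset.Icc_subset_Icc_right n.le_succ ht)) h1.1
    -- Adding `B` makes the numerator nonnegative, so lowering the rate can only enlarge the
    -- quotient.
    have h4 : (k (J (n + 1)) - q (J (n + 1)) + B) / η n ≤
        (k (J (n + 1)) - q (J (n + 1)) + B) / η (n + 1) :=
      div_le_div_of_nonneg_left (by linarith [hB _ h1.1]) (hη _ (by omega)) (hanti n hn)
    rw [Finset.sum_Icc_succ_top (by omega), ← pastLoss_add_one]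
    rw [← pastLoss_add_one] at h3
    rw [pastLoss_succ s (by omega : 1 ≤ n + 1) (J (n + 1))] at h2
    rw [add_div] at h3 h4 ⊢
    rw [add_div (k (J (n + 1)) - q (J (n + 1)))] at h4
    linarith

variable [Countable α]

/-- Stability: if `i` leads before step `t` even with `q i` lowered by `η`, then it also leads after
step `t` with the original `q`. Lowering the coordinate costs at most a factor `exp η` in
probability. -/
lemma measure_fplChoice_le (hS : S.Nonempty)
    (hk : ∑' i : S, ENNReal.ofReal (Real.exp (-k i)) ≠ ∞)
    (hs : ∀ t, 1 ≤ t → ∀ i, 0 ≤ s t i ∧ s t i ≤ 1) {η : ℝ} (hη : 0 < η) {t : ℕ} (ht : 1 ≤ t)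
    (i : α) :
    perturbation α {q | fplChoice S k s η t q = i} ≤
      ENNReal.ofReal (Real.exp η) * perturbation α {q | fplChoice S k s η (t + 1) q = i} := by
  classical
  have hs0 (t : ℕ) (ht : 1 ≤ t) (i : α) : 0 ≤ s t i := (hs t ht i).1
  have h1 := measure_congr (argminOn_ae_eq
    (ae_exists_strictArgmin hS hk (pastLoss_nonneg hs0 t) hη) i)
  have hg (t : ℕ) (i : α) : AEMeasurable (fun q : α → ℝ => pastLoss s t i + (k i - q i) / η)
      (perturbation α) :=
    ((((measurable_pi_apply i).const_sub _).div_const _).const_add _).aemeasurable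
  have h2 := perturbation_le_shift₀ i hη.le (nullMeasurableSet_strictArgmin (S := S) (hg t) i)
  -- Lowering `q i` by `η` raises the perturbed loss of `i` by exactly one, at least as much as `s t
  -- i`, while the rivals only gain `s t j ≥ 0`.
  have h3 : {q | Function.update q i (q i - η) ∈
      {q | StrictArgmin S (fun i => pastLoss s t i + (k i - q i) / η) i}} ⊆
      {q | fplChoice S k s η (t + 1) q = i} := by
    intro q hq
    refine StrictArgmin.argminOn_eq ⟨hq.1, fun j hj hji => ?_⟩
    have h := hq.2 j hj hji
    simp only [Function.update_self, Function.update_of_ne hji] at h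
    simp only [pastLoss_succ s ht]
    have h5 : (k i - (q i - η)) / η = (k i - q i) / η + 1 := by field_simp; ring
    have := (hs t ht i).2
    have := (hs t ht j).1
    linarith
  have h4 := h2.trans (measure_mono h3)
  have h5 : ENNReal.ofReal (Real.exp η) * ENNReal.ofReal (Real.exp (-η)) = 1 := by
    rw [← ENNReal.ofReal_mul (Real.exp_pos _).le, ← Real.exp_add]; simp
  calc perturbation α {q | fplChoice S k s η t q = i}
      = ENNReal.ofReal (Real.exp η) * (ENNReal.ofReal (Real.exp (-η)) *
          perturbation α {q | StrictArgmin S (fun i => pastLoss s t i + (k i - q i) / η) i}) := by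
        rw [← mul_assoc, h5, one_mul]; exact h1
    _ ≤ _ := by gcongr

lemma aestronglyMeasurable_fplLoss (hS : S.Nonempty)
    (hk : ∑' i : S, ENNReal.ofReal (Real.exp (-k i)) ≠ ∞)
    (hs : ∀ t, 1 ≤ t → ∀ i, 0 ≤ s t i ∧ s t i ≤ 1) {η : ℝ} (hη : 0 < η) (t t' : ℕ) :
    AEStronglyMeasurable (fun q => s t (fplChoice S k s η t' q)) (perturbation α) :=
  (aemeasurable_apply_choice (nullMeasurableSet_fplChoice hS hk (fun t ht i => (hs t ht i).1) hη t')
    (g := fun i _ => s t i) fun _ => aemeasurable_const).aestronglyMeasurable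

lemma integrable_fplLoss (hS : S.Nonempty)
    (hk : ∑' i : S, ENNReal.ofReal (Real.exp (-k i)) ≠ ∞)
    (hs : ∀ t, 1 ≤ t → ∀ i, 0 ≤ s t i ∧ s t i ≤ 1) {η : ℝ} (hη : 0 < η) {t : ℕ} (ht : 1 ≤ t)
    (t' : ℕ) :
    Integrable (fun q => s t (fplChoice S k s η t' q)) (perturbation α) := by
  refine .of_bound (aestronglyMeasurable_fplLoss hS hk hs hη t t') 1 (.of_forall fun q => ?_)
  rw [Real.norm_eq_abs, abs_le]
  have := hs t ht (fplChoice S k s η t' q)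
  constructor <;> linarith

lemma expLoss_le_infeasibleLoss (hS : S.Nonempty)
    (hk : ∑' i : S, ENNReal.ofReal (Real.exp (-k i)) ≠ ∞)
    (hs : ∀ t, 1 ≤ t → ∀ i, 0 ≤ s t i ∧ s t i ≤ 1) {η : ℝ} (hη : 0 < η) {t : ℕ} (ht : 1 ≤ t) :
    expLoss S k s η t ≤ Real.exp η * infeasibleLoss S k s η t := by
  have hs0 (t : ℕ) (ht : 1 ≤ t) (i : α) : 0 ≤ s t i := (hs t ht i).1
  have key : ∫⁻ q, ENNReal.ofReal (s t (fplChoice S k s η t q)) ∂(perturbation α) ≤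
      ENNReal.ofReal (Real.exp η) *
        ∫⁻ q, ENNReal.ofReal (s t (fplChoice S k s η (t + 1) q)) ∂(perturbation α) := by
    rw [lintegral_apply_choice (nullMeasurableSet_fplChoice hS hk hs0 hη t)
        (fun i => ENNReal.ofReal (s t i)),
      lintegral_apply_choice (nullMeasurableSet_fplChoice hS hk hs0 hη (t + 1))
        (fun i => ENNReal.ofReal (s t i)), ← ENNReal.tsum_mul_left]
    refine ENNReal.tsum_le_tsum fun i => ?_
    rw [mul_left_comm]
    gcongr
    exact measure_fplChoice_le hS hk hs hη ht i
  have h (t' : ℕ) := ofReal_integral_eq_lintegral_ofReal (integrable_fplLoss hS hk hs hη ht t')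
    (.of_forall fun q => hs0 t ht _)
  rw [← h t, ← h (t + 1), ← ENNReal.ofReal_mul (Real.exp_pos _).le] at key
  refine (ENNReal.ofReal_le_ofReal_iff ?_).1 key
  exact mul_nonneg (Real.exp_pos _).le (integral_nonneg fun q => hs0 t ht _)

omit [Nonempty α] in
/-- An upper bound for all the `q i - k i` with expectation at most one. -/
lemma exists_perturbation_bound (hk : ∑' i : S, ENNReal.ofReal (Real.exp (-k i)) ≤ 1) :
    ∃ B : (α → ℝ) → ℝ, Integrable B (perturbation α) ∧ ∫ q, B q ∂(perturbation α) ≤ 1 ∧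
      ∀ᵐ q ∂(perturbation α), ∀ i ∈ S, q i - k i ≤ B q := by
  -- The supremum is replaced by the sum of positive parts, whose mean is at most `∑ exp (-k i)`.
  let F : (α → ℝ) → ℝ≥0∞ := fun q => ∑' i : S, ENNReal.ofReal (q i - k i)
  have hFm : Measurable F :=
    Measurable.tsum fun i => ((measurable_pi_apply (i : α)).sub_const _).ennreal_ofReal
  have hF : ∫⁻ q, F q ∂(perturbation α) ≤ 1 := by
    rw [lintegral_tsum (f := fun (i : S) (q : α → ℝ) => ENNReal.ofReal (q i - k i)) fun i =>
      ((measurable_pi_apply (i : α)).sub_const _).ennreal_ofReal.aemeasurable]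
    exact (ENNReal.tsum_le_tsum fun i => lintegral_ofReal_perturbation_sub_le _ _).trans hk
  have hF' := ne_top_of_le_ne_top ENNReal.one_ne_top hF
  have hfin := ae_lt_top hFm hF'
  refine ⟨fun q => (F q).toReal, integrable_toReal_of_lintegral_ne_top hFm.aemeasurable hF', ?_, ?_⟩
  · rw [integral_toReal hFm.aemeasurable hfin]
    exact ENNReal.toReal_le_of_le_ofReal zero_le_one (by simpa using hF)
  · filter_upwards [hfin] with q hq i hi
    rw [← ENNReal.ofReal_le_iff_le_toReal hq.ne]
    exact ENNReal.le_tsum (f := fun i : S => ENNReal.ofReal (q i - k i)) ⟨i, hi⟩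

/-- The infeasible FPL has a total loss close to that of each expert. -/
lemma sum_infeasibleLoss_le (hk : ∑' i : S, ENNReal.ofReal (Real.exp (-k i)) ≤ 1)
    (hs : ∀ t, 1 ≤ t → ∀ i, 0 ≤ s t i ∧ s t i ≤ 1) {η : ℕ → ℝ} (hη : ∀ t, 1 ≤ t → 0 < η t)
    (hanti : ∀ t, 1 ≤ t → η (t + 1) ≤ η t) {T : ℕ} (hT : 1 ≤ T) {i : α} (hi : i ∈ S) :
    ∑ t ∈ Finset.Icc 1 T, infeasibleLoss S k s (η t) t ≤ totalLoss s T i + k i / η T := by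
  have hS : S.Nonempty := ⟨i, hi⟩
  have hk' := ne_top_of_le_ne_top ENNReal.one_ne_top hk
  have hs0 (t : ℕ) (ht : 1 ≤ t) (i : α) : 0 ≤ s t i := (hs t ht i).1
  obtain ⟨B, hBi, hB1, hB⟩ := exists_perturbation_bound hk
  have hJ : ∀ᵐ q ∂(perturbation α), ∀ t ∈ Finset.Icc 1 T, ∃ j,
      StrictArgmin S (fun i => pastLoss s (t + 1) i + (k i - q i) / η t) j := by
    rw [Filter.eventually_all_finset]
    exact fun t ht => ae_exists_strictArgmin hS hk' (pastLoss_nonneg hs0 _)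
      (hη t (Finset.mem_Icc.1 ht).1)
  have hint (t : ℕ) (ht : t ∈ Finset.Icc 1 T) :
      Integrable (fun q => s t (fplChoice S k s (η t) (t + 1) q)) (perturbation α) :=
    integrable_fplLoss hS hk' hs (hη t (Finset.mem_Icc.1 ht).1) (Finset.mem_Icc.1 ht).1 (t + 1)
  have hqi : Integrable (fun q : α → ℝ => k i - q i) (perturbation α) :=
    (integrable_const _).sub (integrable_perturbation_apply i)
  have hRi : Integrable (fun q : α → ℝ => ((k i - q i) + B q) / η T) (perturbation α) :=
    (hqi.add hBi).div_const _
  calc ∑ t ∈ Finset.Icc 1 T, infeasibleLoss S k s (η t) t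
      = ∫ q, ∑ t ∈ Finset.Icc 1 T, s t (fplChoice S k s (η t) (t + 1) q) ∂(perturbation α) :=
        (integral_finsetSum _ hint).symm
    _ ≤ ∫ q, (totalLoss s T i + ((k i - q i) + B q) / η T) ∂(perturbation α) := by
        refine integral_mono_ae (integrable_finsetSum _ hint) ?_ ?_
        · exact (integrable_const _).add hRi
        · filter_upwards [hB, hJ] with q h1 h2
          refine sum_leader_le hη hanti h1 hT (J := fun t => fplChoice S k s (η t) (t + 1) q)
            (fun t ht => ?_) hi
          obtain ⟨j, hj⟩ := h2 t ht
          have : fplChoice S k s (η t) (t + 1) q = j := hj.argminOn_eq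
          rw [this]; exact hj
    -- The `-1` is the mean of `q i`; it absorbs the mean of `B`, leaving `k i / η T`.
    _ = totalLoss s T i + ((k i - 1) + ∫ q, B q ∂(perturbation α)) / η T := by
        rw [integral_add (integrable_const _) hRi, integral_div, integral_add hqi hBi,
          integral_sub (integrable_const _) (integrable_perturbation_apply i),
          integral_perturbation_apply]
        simp
    _ ≤ _ := by
        have := (hη T hT).le
        gcongr
        linarith

omit [Countable α] in
lemma expLoss_nonneg (hs : ∀ t, 1 ≤ t → ∀ i, 0 ≤ s t i ∧ s t i ≤ 1) (η : ℝ) {t : ℕ} (ht : 1 ≤ t) :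
    0 ≤ expLoss S k s η t := integral_nonneg fun _ => (hs t ht _).1

omit [Countable α] in
lemma infeasibleLoss_nonneg (hs : ∀ t, 1 ≤ t → ∀ i, 0 ≤ s t i ∧ s t i ≤ 1) (η : ℝ) {t : ℕ}
    (ht : 1 ≤ t) : 0 ≤ infeasibleLoss S k s η t := integral_nonneg fun _ => (hs t ht _).1

lemma integral_le_one_of_le {Ω : Type*} [MeasurableSpace Ω] {μ : Measure Ω}
    [IsProbabilityMeasure μ] {f : Ω → ℝ} (h0 : ∀ x, 0 ≤ f x) (h : ∀ x, f x ≤ 1) :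
    ∫ x, f x ∂μ ≤ 1 := by
  calc ∫ x, f x ∂μ ≤ ∫ _, 1 ∂μ :=
        integral_mono_of_nonneg (.of_forall h0) (integrable_const _) (.of_forall h)
    _ = 1 := by simp

omit [Countable α] in
lemma expLoss_le_one (hs : ∀ t, 1 ≤ t → ∀ i, 0 ≤ s t i ∧ s t i ≤ 1) (η : ℝ) {t : ℕ} (ht : 1 ≤ t) :
    expLoss S k s η t ≤ 1 :=
  integral_le_one_of_le (fun _ => (hs t ht _).1) (fun _ => (hs t ht _).2)

omit [Countable α] in
lemma infeasibleLoss_le_one (hs : ∀ t, 1 ≤ t → ∀ i, 0 ≤ s t i ∧ s t i ≤ 1) (η : ℝ) {t : ℕ}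
    (ht : 1 ≤ t) : infeasibleLoss S k s η t ≤ 1 :=
  integral_le_one_of_le (fun _ => (hs t ht _).1) (fun _ => (hs t ht _).2)

/-- The loss of FPL, in terms of the learning rates and of its own expected losses. -/
lemma sum_expLoss_le (hk : ∑' i : S, ENNReal.ofReal (Real.exp (-k i)) ≤ 1)
    (hs : ∀ t, 1 ≤ t → ∀ i, 0 ≤ s t i ∧ s t i ≤ 1) {η : ℕ → ℝ} (hη : ∀ t, 1 ≤ t → 0 < η t)
    (hanti : ∀ t, 1 ≤ t → η (t + 1) ≤ η t) {T : ℕ} (hT : 1 ≤ T) {i : α} (hi : i ∈ S) :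
    ∑ t ∈ Finset.Icc 1 T, expLoss S k s (η t) t ≤
      totalLoss s T i + k i / η T + ∑ t ∈ Finset.Icc 1 T, η t * expLoss S k s (η t) t := by
  have hk' := ne_top_of_le_ne_top ENNReal.one_ne_top hk
  have h1 := sum_infeasibleLoss_le hk hs hη hanti hT hi
  have h2 : ∀ t ∈ Finset.Icc 1 T, expLoss S k s (η t) t ≤
      infeasibleLoss S k s (η t) t + η t * expLoss S k s (η t) t := by
    intro t ht
    have ht := (Finset.mem_Icc.1 ht).1
    have h3 := expLoss_le_infeasibleLoss ⟨i, hi⟩ hk' hs (hη t ht) ht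
    -- Using `exp (-η) ≥ 1 - η` on the feasible side expresses the error through FPL's own loss, as
    -- the self-confident rates require, and needs no bound `η ≤ 1`.
    have h4 := Real.add_one_le_exp (-η t)
    have h5 := expLoss_nonneg (S := S) (k := k) hs (η t) ht
    have h6 : Real.exp (-η t) * expLoss S k s (η t) t ≤ infeasibleLoss S k s (η t) t := by
      calc _ ≤ Real.exp (-η t) * (Real.exp (η t) * infeasibleLoss S k s (η t) t) := by gcongr
        _ = _ := by rw [← mul_assoc, ← Real.exp_add]; simp
    nlinarith
  have h3 := Finset.sum_le_sum h2
  rw [Finset.sum_add_distrib] at h3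
  linarith

end Generic

/-! ### Telescoping sums, a quadratic inequality and summation by parts. -/

section Sequences

/-- `x = (√(a + x) - √a) (√(a + x) + √a)`, and both roots in the second factor are at most `√(a +
1)`. The `+ 1` pays for the loss of the current step not yet being counted in `a`. -/
lemma div_sqrt_add_one_le {a x : ℝ} (ha : 0 ≤ a) (hx : 0 ≤ x) (hx1 : x ≤ 1) :
    x / √(a + 1) ≤ 2 * (√(a + x) - √a) := by
  rw [div_le_iff₀ (by positivity)]
  have h1 : √(a + x) ≤ √(a + 1) := by gcongr
  have h2 : √a ≤ √(a + 1) := by gcongr; linarith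
  have h3 : √a ≤ √(a + x) := by gcongr; linarith
  have h4 := Real.sq_sqrt ha
  have h5 := Real.sq_sqrt (show 0 ≤ a + x by linarith)
  nlinarith

lemma sum_div_sqrt_le {x : ℕ → ℝ} (hx : ∀ t, 1 ≤ t → 0 ≤ x t ∧ x t ≤ 1) (T : ℕ) :
    ∑ t ∈ Finset.Icc 1 T, x t / √(∑ τ ∈ Finset.Icc 1 (t - 1), x τ + 1) ≤
      2 * √(∑ t ∈ Finset.Icc 1 T, x t) := by
  induction T with
  | zero => simp
  | succ n ih =>
    have h0 : 0 ≤ ∑ τ ∈ Finset.Icc 1 n, x τ :=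
      Finset.sum_nonneg fun t ht => (hx t (Finset.mem_Icc.1 ht).1).1
    have h1 := div_sqrt_add_one_le h0 (hx (n + 1) (by omega)).1 (hx (n + 1) (by omega)).2
    rw [Finset.sum_Icc_succ_top (by omega), Finset.sum_Icc_succ_top (by omega),
      Nat.add_sub_cancel]
    linarith

lemma sum_one_div_sqrt_le (T : ℕ) : ∑ t ∈ Finset.Icc 1 T, 1 / √(t : ℝ) ≤ 2 * √(T : ℝ) := by
  have h := sum_div_sqrt_le (x := fun _ => 1) (by simp) T
  simp only [Finset.sum_const, Nat.card_Icc, nsmul_eq_mul, mul_one, Nat.add_sub_cancel] at h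
  refine le_trans (le_of_eq (Finset.sum_congr rfl fun t ht => ?_)) h
  rw [Nat.cast_sub (Finset.mem_Icc.1 ht).1]
  simp

/-- The hypothesis forces `√y ≤ c + √b`, which is then substituted back. This resolves recursive
regret bounds. -/
lemma le_of_le_add_mul_sqrt {y b c : ℝ} (hy : 0 ≤ y) (hb : 0 ≤ b) (hc : 0 ≤ c)
    (h : y ≤ b + c * √y) : y ≤ b + c * √b + c ^ 2 := by
  have h1 : √y ≤ c + √b := by
    by_contra hlt
    push Not at hlt
    have := Real.sq_sqrt hy
    have := Real.sq_sqrt hb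
    have := Real.sqrt_nonneg b
    nlinarith
  nlinarith [Real.sqrt_nonneg y]

/-- Summation by parts against nonincreasing weights, with a potential function `Ψ`. -/
lemma sum_mul_le_of_potential {w r R Ψ : ℕ → ℝ} (hw : ∀ t, 1 ≤ t → 0 ≤ w t)
    (hanti : ∀ t, 1 ≤ t → w (t + 1) ≤ w t)
    (hr : ∀ t, 1 ≤ t → ∑ τ ∈ Finset.Icc 1 t, r τ ≤ R t) (h1 : w 1 * R 1 ≤ Ψ 1)
    (hstep : ∀ t, 1 ≤ t → w (t + 1) * (R (t + 1) - R t) ≤ Ψ (t + 1) - Ψ t) {T : ℕ} (hT : 1 ≤ T) :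
    ∑ t ∈ Finset.Icc 1 T, w t * r t ≤ Ψ T := by
  -- The induction needs the slack `R T - ∑ r` kept on the left: it is nonnegative, so its weight
  -- may decrease from `w n` to `w (n + 1)`.
  have key : ∑ t ∈ Finset.Icc 1 T, w t * r t + w T * (R T - ∑ t ∈ Finset.Icc 1 T, r t) ≤ Ψ T := by
    induction T, hT using Nat.le_induction with
    | base => simp only [Finset.Icc_self, Finset.sum_singleton]; linarith
    | succ n hn ih =>
      rw [Finset.sum_Icc_succ_top (by omega), Finset.sum_Icc_succ_top (by omega)]
      have := hstep n hn
      nlinarith [mul_nonneg (sub_nonneg.2 (hanti n hn)) (sub_nonneg.2 (hr n hn))]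
  have := mul_nonneg (hw T hT) (sub_nonneg.2 (hr T hT))
  linarith

lemma exp_le_one_add_add_sq {x : ℝ} (h0 : 0 ≤ x) (h1 : x ≤ 1) : Real.exp x ≤ 1 + (x + x ^ 2) := by
  have := Real.abs_exp_sub_one_sub_id_le (x := x) (by rwa [abs_of_nonneg h0])
  linarith [(abs_le.1 this).2]

end Sequences

/-! ### FPL with time-dependent and self-confident rates. -/

section Generic

variable {α : Type*} [Nonempty α] {S : Set α} {k : α → ℝ} {s : ℕ → α → ℝ}

lemma totalLoss_nonneg {β : Type*} {s : ℕ → β → ℝ} (hs : ∀ t, 1 ≤ t → ∀ i, 0 ≤ s t i ∧ s t i ≤ 1)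
    (T : ℕ) (i : β) : 0 ≤ totalLoss s T i :=
  pastLoss_nonneg (fun t ht i => (hs t ht i).1) (T + 1) i

/-- FPL with the learning rate `a / √t`. -/
lemma sum_expLoss_time_le [Countable α] (hk : ∑' i : S, ENNReal.ofReal (Real.exp (-k i)) ≤ 1)
    (hs : ∀ t, 1 ≤ t → ∀ i, 0 ≤ s t i ∧ s t i ≤ 1) {a : ℝ} (ha : 0 < a) (T : ℕ) {i : α}
    (hi : i ∈ S) :
    ∑ t ∈ Finset.Icc 1 T, expLoss S k s (a / √(t : ℝ)) t ≤
      totalLoss s T i + (k i / a + 2 * a) * √(T : ℝ) := by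
  rcases Nat.eq_zero_or_pos T with rfl | hT
  · simp [totalLoss]
  have h := sum_expLoss_le (η := fun t => a / √(t : ℝ)) hk hs
    (fun t ht => div_pos ha (Real.sqrt_pos.2 (by exact_mod_cast ht)))
    (fun t ht => div_le_div_of_nonneg_left ha.le (Real.sqrt_pos.2 (by exact_mod_cast ht))
      (Real.sqrt_le_sqrt (by push_cast; linarith))) hT hi
  have h2 : ∑ t ∈ Finset.Icc 1 T, a / √(t : ℝ) * expLoss S k s (a / √(t : ℝ)) t ≤
      a * (2 * √(T : ℝ)) := by
    refine le_trans (Finset.sum_le_sum (g := fun t : ℕ => a * (1 / √(t : ℝ))) fun t ht => ?_) ?_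
    · rw [mul_one_div]
      exact mul_le_of_le_one_right (by positivity)
        (expLoss_le_one hs _ (Finset.mem_Icc.1 ht).1)
    · rw [← Finset.mul_sum]
      gcongr
      exact sum_one_div_sqrt_le T
  have h3 : k i / (a / √(T : ℝ)) = k i / a * √(T : ℝ) := by
    rw [div_div_eq_mul_div]; ring
  simp only [h3] at h
  nlinarith

lemma selfConfidentLoss_succ (S : Set α) (k : α → ℝ) (s : ℕ → α → ℝ) (rate : ℝ → ℝ) (t : ℕ) :
    selfConfidentLoss S k s rate (t + 1) = selfConfidentLoss S k s rate t +
      expLoss S k s (rate (selfConfidentLoss S k s rate t)) (t + 1) := rfl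

lemma selfConfidentLoss_eq_sum (S : Set α) (k : α → ℝ) (s : ℕ → α → ℝ) (rate : ℝ → ℝ) (T : ℕ) :
    selfConfidentLoss S k s rate T =
      ∑ t ∈ Finset.Icc 1 T, expLoss S k s (rate (selfConfidentLoss S k s rate (t - 1))) t := by
  induction T with
  | zero => simp [selfConfidentLoss]
  | succ n ih =>
    rw [selfConfidentLoss_succ, Finset.sum_Icc_succ_top (by omega), ← ih, Nat.add_sub_cancel]

lemma selfConfidentLoss_le_succ (hs : ∀ t, 1 ≤ t → ∀ i, 0 ≤ s t i ∧ s t i ≤ 1) (rate : ℝ → ℝ)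
    (t : ℕ) : selfConfidentLoss S k s rate t ≤ selfConfidentLoss S k s rate (t + 1) := by
  rw [selfConfidentLoss_succ]
  linarith [expLoss_nonneg (S := S) (k := k) hs (rate (selfConfidentLoss S k s rate t))
    (show 1 ≤ t + 1 by omega)]

lemma selfConfidentLoss_nonneg (hs : ∀ t, 1 ≤ t → ∀ i, 0 ≤ s t i ∧ s t i ≤ 1) (rate : ℝ → ℝ)
    (t : ℕ) : 0 ≤ selfConfidentLoss S k s rate t := by
  induction t with
  | zero => exact le_rfl
  | succ n ih => exact ih.trans (selfConfidentLoss_le_succ hs rate n)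

lemma div_sqrt_antitone {a x y : ℝ} (ha : 0 ≤ a) (hx : 0 ≤ x) (hxy : x ≤ y) :
    a / √(y + 1) ≤ a / √(x + 1) := by
  gcongr

/-- FPL with the self-confident learning rate `a / √(ℓ + 1)`. -/
lemma selfConfidentLoss_le [Countable α] (hk : ∑' i : S, ENNReal.ofReal (Real.exp (-k i)) ≤ 1)
    (hk0 : ∀ i ∈ S, 0 ≤ k i)
    (hs : ∀ t, 1 ≤ t → ∀ i, 0 ≤ s t i ∧ s t i ≤ 1) {a : ℝ} (ha : 0 < a) {rate : ℝ → ℝ}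
    (hrate : ∀ l, 0 ≤ l → rate l = a / √(l + 1)) (T : ℕ) {i : α} (hi : i ∈ S) :
    selfConfidentLoss S k s rate T ≤ totalLoss s T i +
      (k i / a + 2 * a) * √(totalLoss s T i + 1) + (k i / a + 2 * a) ^ 2 := by
  have hc : 0 ≤ k i / a + 2 * a := by have := hk0 i hi; positivity
  have hs0 := totalLoss_nonneg hs T i
  rcases Nat.eq_zero_or_pos T with rfl | hT
  · have : 0 ≤ totalLoss s 0 i + (k i / a + 2 * a) * √(totalLoss s 0 i + 1) +
      (k i / a + 2 * a) ^ 2 := by positivity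
    simpa [selfConfidentLoss] using this
  set L := selfConfidentLoss S k s rate with hL
  have hL0 (t : ℕ) : 0 ≤ L t := selfConfidentLoss_nonneg hs rate t
  have hLs (t : ℕ) : L t ≤ L (t + 1) := selfConfidentLoss_le_succ hs rate t
  have hr (t : ℕ) : rate (L t) = a / √(L t + 1) := hrate _ (hL0 t)
  have h := sum_expLoss_le (η := fun t => rate (L (t - 1))) hk hs
    (fun t ht => by rw [hr]; have := hL0 (t - 1); positivity)
    (fun t ht => by
      obtain ⟨n, rfl⟩ : ∃ n, t = n + 1 := ⟨t - 1, by omega⟩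
      rw [hr, hr]
      exact div_sqrt_antitone ha.le (hL0 _) (hLs n)) hT hi
  rw [← selfConfidentLoss_eq_sum] at h
  have h2 : ∑ t ∈ Finset.Icc 1 T, rate (L (t - 1)) * expLoss S k s (rate (L (t - 1))) t ≤
      a * (2 * √(L T)) := by
    have h3 := sum_div_sqrt_le (x := fun t => expLoss S k s (rate (L (t - 1))) t)
      (fun t ht => ⟨expLoss_nonneg hs _ ht, expLoss_le_one hs _ ht⟩) T
    simp only [hL, ← selfConfidentLoss_eq_sum] at h3
    simp only [← hL] at h3
    refine le_trans (le_of_eq ?_) (mul_le_mul_of_nonneg_left h3 ha.le)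
    rw [Finset.mul_sum]
    refine Finset.sum_congr rfl fun t ht => ?_
    rw [hr (t - 1)]; ring
  have h4 : k i / rate (L (T - 1)) ≤ k i / a * √(L T + 1) := by
    -- The rate at time `T` uses the loss up to `T - 1`; monotonicity of `L` allows `L T` instead,
    -- so that one unknown remains.
    obtain ⟨n, rfl⟩ : ∃ n, T = n + 1 := ⟨T - 1, by omega⟩
    rw [Nat.add_sub_cancel, hr, div_div_eq_mul_div, mul_div_right_comm]
    have := hk0 i hi
    have := hLs n
    gcongr
  have h5 : √(L T) ≤ √(L T + 1) := by gcongr; linarith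
  -- The quadratic inequality is solved for `L T + 1`, the quantity under the root.
  have h6 : L T + 1 ≤ (totalLoss s T i + 1) + (k i / a + 2 * a) * √(L T + 1) := by
    simp only [← hL] at h
    nlinarith
  have := le_of_le_add_mul_sqrt (by have := hL0 T; linarith) (by linarith) hc h6
  linarith

end Generic

/-! ### Estimates for the rate based on a best past loss. -/

section Sequences

lemma sqrt_add_le_add {x y : ℝ} (hx : 0 ≤ x) (hy : 0 ≤ y) : √(x + y) ≤ √x + √y := by
  have := Real.sqrt_nonneg x
  have := Real.sqrt_nonneg y
  refine Real.sqrt_le_iff.2 ⟨by positivity, ?_⟩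
  nlinarith [Real.sq_sqrt hx, Real.sq_sqrt hy]

/-- The inverse of the learning rate based on a best past loss `m`. -/
noncomputable def invBestRate (K m : ℝ) : ℝ := √2 * max 1 √(m / K)

variable {K m m' : ℝ}

lemma sqrt_two_le_invBestRate : √2 ≤ invBestRate K m :=
  le_mul_of_one_le_right (Real.sqrt_nonneg _) (le_max_left _ _)

lemma one_le_invBestRate : 1 ≤ invBestRate K m :=
  (Real.one_le_sqrt.2 one_le_two).trans sqrt_two_le_invBestRate

lemma invBestRate_pos : 0 < invBestRate K m := zero_lt_one.trans_le one_le_invBestRate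

lemma invBestRate_mono (hK : 1 ≤ K) (h : m ≤ m') : invBestRate K m ≤ invBestRate K m' := by
  unfold invBestRate; gcongr

/-- The mediant `(m + 1) / (K + 1)` of `m / K` and `1 / 1` is at most their maximum. This trades the
maximum for a function of `m + 1` whose sums telescope. -/
lemma le_sq_invBestRate (hK : 1 ≤ K) (hm : 0 ≤ m) :
    2 * (m + 1) / (K + 1) ≤ invBestRate K m ^ 2 := by
  have h0 : 0 ≤ m / K := by positivity
  rw [invBestRate, mul_pow, Real.sq_sqrt zero_le_two, mul_div_assoc]
  gcongr
  rcases le_total m K with h | h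
  · calc (m + 1) / (K + 1) ≤ 1 ^ 2 := by rw [one_pow, div_le_one (by linarith)]; linarith
      _ ≤ _ := by gcongr; exact le_max_left _ _
  · calc (m + 1) / (K + 1) ≤ m / K := by
          rw [div_le_div_iff₀ (by linarith) (by linarith)]; nlinarith
      _ = √(m / K) ^ 2 := (Real.sq_sqrt h0).symm
      _ ≤ _ := by gcongr; exact le_max_right _ _

lemma inv_invBestRate_le (hK : 1 ≤ K) (hm : 0 ≤ m) :
    1 / invBestRate K m ≤ √(2 * (K + 1)) / 2 / √(m + 1) := by
  have h := le_sq_invBestRate hK hm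
  have h1 : √(2 * (m + 1) / (K + 1)) ≤ invBestRate K m := Real.sqrt_le_iff.2 ⟨invBestRate_pos.le, h⟩
  have h2 : √(2 * (m + 1) / (K + 1)) * √(2 * (K + 1)) = 2 * √(m + 1) := by
    rw [← Real.sqrt_mul (by positivity), show 2 * (m + 1) / (K + 1) * (2 * (K + 1)) =
      2 ^ 2 * (m + 1) by field_simp, Real.sqrt_mul (by positivity),
      Real.sqrt_sq zero_le_two]
  rw [div_div, div_le_div_iff₀ invBestRate_pos (by positivity)]
  have := mul_le_mul_of_nonneg_right h1 (Real.sqrt_nonneg (2 * (K + 1)))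
  linarith

/-- From `log y ≥ 1 - 1 / y` at the quotient of the arguments; the factor two pays for `m + x + 1 ≤
2 (m + 1)`. -/
lemma div_add_one_le_log {x : ℝ} (hm : 0 ≤ m) (hx : 0 ≤ x) (hx1 : x ≤ 1) :
    x / (m + 1) ≤ 2 * (Real.log (m + x + 1) - Real.log (m + 1)) := by
  have h1 := Real.one_sub_inv_le_log_of_pos (x := (m + x + 1) / (m + 1)) (by positivity)
  rw [Real.log_div (by positivity) (by positivity), inv_div] at h1
  have h2 : x / (m + 1) ≤ 2 * (1 - (m + 1) / (m + x + 1)) := by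
    rw [one_sub_div (by positivity), ← mul_div_assoc, div_le_div_iff₀ (by positivity) (by positivity)]
    nlinarith
  linarith

/-- One step of the potential. The three terms on the right pay, in order, for `m' - m` weighted by
`1 / v`, for `m' - m` weighted by `(1 / v) ^ 2`, and for `K * (v - u)`, where the weight is at most
`2 / v`. -/
lemma bestRate_step {u v : ℝ} (hK : 1 ≤ K) (hm : 0 ≤ m) (hmm' : m ≤ m') (hm1 : m' ≤ m + 1)
    (hv : v = invBestRate K m) (hu : √2 ≤ u) (huv : u ≤ v) :
    (1 / v + (1 / v) ^ 2) * ((m' - m) + K * (v - u)) ≤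
      √(2 * (K + 1)) * (√m' - √m) + (K + 1) * (Real.log (m' + 1) - Real.log (m + 1)) +
        2 * K * (Real.log v - Real.log u) := by
  have hv1 : 1 ≤ v := hv ▸ one_le_invBestRate
  have hu0 : 0 < u := (Real.sqrt_pos.2 two_pos).trans_le hu
  have hv0 : 0 < v := hu0.trans_le huv
  obtain ⟨x, rfl⟩ : ∃ x, m' = m + x := ⟨m' - m, by ring⟩
  have hx : 0 ≤ x := by linarith
  have hx1 : x ≤ 1 := by linarith
  have e1 : 1 / v * x ≤ √(2 * (K + 1)) * (√(m + x) - √m) := by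
    calc 1 / v * x ≤ √(2 * (K + 1)) / 2 / √(m + 1) * x := by
          have := inv_invBestRate_le hK hm
          rw [← hv] at this
          gcongr
      _ = √(2 * (K + 1)) / 2 * (x / √(m + 1)) := by ring
      _ ≤ √(2 * (K + 1)) / 2 * (2 * (√(m + x) - √m)) := by
          gcongr; exact div_sqrt_add_one_le hm hx hx1
      _ = _ := by ring
  have e2 : (1 / v) ^ 2 * x ≤ (K + 1) * (Real.log (m + x + 1) - Real.log (m + 1)) := by
    have h1 : (1 / v) ^ 2 ≤ (K + 1) / 2 * (1 / (m + 1)) := by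
      rw [one_div_pow, ← one_div_div, mul_one_div, div_div_eq_mul_div, one_mul,
        one_div_le (by positivity) (by positivity), one_div_div]
      refine le_trans (le_of_eq ?_) (hv ▸ le_sq_invBestRate hK hm)
      field_simp
    calc (1 / v) ^ 2 * x ≤ (K + 1) / 2 * (1 / (m + 1)) * x := by gcongr
      _ = (K + 1) / 2 * (x / (m + 1)) := by ring
      _ ≤ (K + 1) / 2 * (2 * (Real.log (m + x + 1) - Real.log (m + 1))) := by
          gcongr; exact div_add_one_le_log hm hx hx1
      _ = _ := by ring
  have e3 : (1 / v + (1 / v) ^ 2) * (K * (v - u)) ≤ 2 * K * (Real.log v - Real.log u) := by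
    have h1 : 1 / v ≤ 1 := by rw [div_le_one hv0]; exact hv1
    have h2 : (1 / v) ^ 2 ≤ 1 / v := by
      rw [sq]; exact mul_le_of_le_one_left (by positivity) h1
    have h3 := Real.one_sub_inv_le_log_of_pos (x := v / u) (by positivity)
    rw [Real.log_div hv0.ne' hu0.ne', inv_div] at h3
    calc (1 / v + (1 / v) ^ 2) * (K * (v - u)) ≤ (1 / v + 1 / v) * (K * (v - u)) := by
          have : 0 ≤ K * (v - u) := mul_nonneg (by linarith) (by linarith)
          gcongr
      _ = 2 * K * (1 - u / v) := by field_simp; ring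
      _ ≤ _ := by gcongr
  have : x = (m + x) - m := by ring
  rw [← this]
  nlinarith

end Sequences

/-! ### FPL with a rate based on the best past loss. -/

section Generic

variable {α : Type*} {S : Set α} {k : α → ℝ} {s : ℕ → α → ℝ}

/-- The best past loss of the experts in `S`. -/
noncomputable def minLossOn (S : Set α) (s : ℕ → α → ℝ) (t : ℕ) : ℝ := ⨅ i : S, pastLoss s t i

lemma bddBelow_pastLoss (hs : ∀ t, 1 ≤ t → ∀ i, 0 ≤ s t i ∧ s t i ≤ 1) (t : ℕ) :
    BddBelow (Set.range fun i : S => pastLoss s t i) :=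
  ⟨0, by rintro _ ⟨i, rfl⟩; exact pastLoss_nonneg (fun t ht i => (hs t ht i).1) t i⟩

lemma minLossOn_le (hs : ∀ t, 1 ≤ t → ∀ i, 0 ≤ s t i ∧ s t i ≤ 1) (t : ℕ) {i : α} (hi : i ∈ S) :
    minLossOn S s t ≤ pastLoss s t i :=
  ciInf_le (bddBelow_pastLoss hs t) ⟨i, hi⟩

lemma minLossOn_nonneg (hs : ∀ t, 1 ≤ t → ∀ i, 0 ≤ s t i ∧ s t i ≤ 1) (t : ℕ) :
    0 ≤ minLossOn S s t :=
  Real.iInf_nonneg fun i => pastLoss_nonneg (fun t ht i => (hs t ht i).1) t i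

lemma minLossOn_le_succ (hS : S.Nonempty) (hs : ∀ t, 1 ≤ t → ∀ i, 0 ≤ s t i ∧ s t i ≤ 1) {t : ℕ}
    (ht : 1 ≤ t) : minLossOn S s t ≤ minLossOn S s (t + 1) := by
  have := hS.to_subtype
  refine le_ciInf fun i => (minLossOn_le hs t i.2).trans ?_
  rw [pastLoss_succ s ht]
  linarith [(hs t ht i).1]

lemma minLossOn_succ_le (hS : S.Nonempty) (hs : ∀ t, 1 ≤ t → ∀ i, 0 ≤ s t i ∧ s t i ≤ 1) {t : ℕ}
    (ht : 1 ≤ t) : minLossOn S s (t + 1) ≤ minLossOn S s t + 1 := by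
  have := hS.to_subtype
  rw [← sub_le_iff_le_add]
  refine le_ciInf fun i => ?_
  have := minLossOn_le hs (t + 1) i.2
  rw [pastLoss_succ s ht] at this
  linarith [(hs t ht i).2]

lemma minLossOn_one (S : Set α) (s : ℕ → α → ℝ) : minLossOn S s 1 = 0 := by
  simp [minLossOn, pastLoss_one]

variable [Nonempty α] [Countable α]

/-- Since `exp x ≤ 1 + x + x ^ 2` on `[0, 1]`, FPL exceeds the infeasible FPL by its losses `r t`
with nonincreasing weights. The partial sums of `r` are at most `m (t + 1) + K * u t`, by minimising
the infeasible bound over the experts, so summation by parts applies. -/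
lemma sum_expLoss_bestRate_aux (hk : ∑' i : S, ENNReal.ofReal (Real.exp (-k i)) ≤ 1)
    (hs : ∀ t, 1 ≤ t → ∀ i, 0 ≤ s t i ∧ s t i ≤ 1) {K : ℝ} (hK : 1 ≤ K)
    (hkK : ∀ i ∈ S, k i ≤ K) (hS : S.Nonempty) {T : ℕ} (hT : 1 ≤ T) :
    ∑ t ∈ Finset.Icc 1 T, expLoss S k s (1 / invBestRate K (minLossOn S s t)) t ≤
      minLossOn S s (T + 1) + K * invBestRate K (minLossOn S s T) +
        (√(2 * (K + 1)) * √(minLossOn S s (T + 1)) +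
          (K + 1) * Real.log (minLossOn S s (T + 1) + 1) +
          2 * K * Real.log (invBestRate K (minLossOn S s T)) + 4 * K) := by
  set m := minLossOn S s
  set u : ℕ → ℝ := fun t => invBestRate K (m t)
  set r : ℕ → ℝ := fun t => infeasibleLoss S k s (1 / u t) t
  have hk' := ne_top_of_le_ne_top ENNReal.one_ne_top hk
  have hu (t : ℕ) : 0 < u t := invBestRate_pos
  have hu1 (t : ℕ) : 1 ≤ u t := one_le_invBestRate
  have hmono (t : ℕ) (ht : 1 ≤ t) : u t ≤ u (t + 1) :=
    invBestRate_mono hK (minLossOn_le_succ hS hs ht)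
  have hanti (t : ℕ) (ht : 1 ≤ t) : 1 / u (t + 1) ≤ 1 / u t :=
    one_div_le_one_div_of_le (hu t) (hmono t ht)
  have hR (t : ℕ) (ht : 1 ≤ t) : ∑ τ ∈ Finset.Icc 1 t, r τ ≤ m (t + 1) + K * u t := by
    have := hS.to_subtype
    rw [← sub_le_iff_le_add]
    refine le_ciInf fun i => ?_
    have h := sum_infeasibleLoss_le hk hs (fun t _ => one_div_pos.2 (hu t)) hanti ht i.2
    rw [div_div_eq_mul_div, div_one] at h
    have := mul_le_mul_of_nonneg_right (hkK i i.2) (hu t).le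
    rw [pastLoss_add_one]
    linarith
  have hw := sum_mul_le_of_potential (w := fun t => 1 / u t + (1 / u t) ^ 2) (r := r)
    (R := fun t => m (t + 1) + K * u t)
    (Ψ := fun t => √(2 * (K + 1)) * √(m (t + 1)) + (K + 1) * Real.log (m (t + 1) + 1) +
      2 * K * Real.log (u t) + 4 * K)
    (fun t _ => by have := hu t; positivity)
    (fun t ht => by
      have h1 := hanti t ht
      have h2 : 0 < 1 / u (t + 1) := one_div_pos.2 (hu _)
      show 1 / u (t + 1) + (1 / u (t + 1)) ^ 2 ≤ 1 / u t + (1 / u t) ^ 2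
      gcongr)
    hR
    (by
      have h1 : u 1 = √2 := by simp [u, m, minLossOn_one, invBestRate]
      have h2 : 1 / u 1 ≤ 1 := by rw [div_le_one (hu 1)]; exact hu1 1
      have h3 : 0 < 1 / u 1 := one_div_pos.2 (hu _)
      have h4 : m (1 + 1) ≤ 1 := by
        have := minLossOn_succ_le hS hs le_rfl
        rwa [minLossOn_one, zero_add] at this
      have h5 : 0 ≤ m (1 + 1) := minLossOn_nonneg hs _
      have h6 : 0 ≤ Real.log (u 1) := Real.log_nonneg (hu1 1)
      have h7 : 0 ≤ Real.log (m (1 + 1) + 1) := Real.log_nonneg (by linarith)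
      have h8 : (1 / u 1) * u 1 = 1 := by field_simp [(hu 1).ne']
      -- The weight is at most `2` and `m 2 ≤ 1`, which gives `2 + 2 K ≤ 4 K`: the origin of the
      -- constant in the potential.
      have h9 : (1 / u 1 + (1 / u 1) ^ 2) * (m (1 + 1) + K * u 1) ≤ 4 * K := by
        have e : (1 / u 1 + (1 / u 1) ^ 2) * (m (1 + 1) + K * u 1) =
          (1 / u 1 + (1 / u 1) ^ 2) * m (1 + 1) + K * ((1 / u 1) * u 1) * (1 + 1 / u 1) := by ring
        rw [e, h8]
        nlinarith
      have h10 : 0 ≤ √(2 * (K + 1)) * √(m (1 + 1)) := by positivity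
      have h11 : 0 ≤ (K + 1) * Real.log (m (1 + 1) + 1) := by positivity
      have h12 : 0 ≤ 2 * K * Real.log (u 1) := by positivity
      linarith)
    (fun t ht => by
      have := bestRate_step hK (minLossOn_nonneg hs (t + 1)) (minLossOn_le_succ hS hs
        (show 1 ≤ t + 1 by omega)) (minLossOn_succ_le hS hs (show 1 ≤ t + 1 by omega))
        (rfl : u (t + 1) = _) (sqrt_two_le_invBestRate : √2 ≤ u t) (hmono t ht)
      refine le_trans (le_of_eq ?_) (this.trans (le_of_eq ?_))
      · simp only [m]; ring
      · simp only [m]; ring) hT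
  have hL : ∀ t ∈ Finset.Icc 1 T, expLoss S k s (1 / u t) t ≤
      r t + (1 / u t + (1 / u t) ^ 2) * r t := by
    intro t ht
    have ht := (Finset.mem_Icc.1 ht).1
    have h1 := expLoss_le_infeasibleLoss hS hk' hs (one_div_pos.2 (hu t)) ht
    have h2 := exp_le_one_add_add_sq (one_div_pos.2 (hu t)).le
      (by rw [div_le_one (hu t)]; exact hu1 t)
    have h3 : 0 ≤ r t := infeasibleLoss_nonneg hs _ ht
    have h4 := mul_le_mul_of_nonneg_right h2 h3
    simp only [r] at h4 ⊢
    linarith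
  have hsum := Finset.sum_le_sum hL
  rw [Finset.sum_add_distrib] at hsum
  have := hR T hT
  simp only [u] at *
  linarith

/-- FPL with a learning rate based on the best past loss. -/
lemma sum_expLoss_bestRate_le (hk : ∑' i : S, ENNReal.ofReal (Real.exp (-k i)) ≤ 1)
    (hs : ∀ t, 1 ≤ t → ∀ i, 0 ≤ s t i ∧ s t i ≤ 1) {K : ℝ} (hK : 1 ≤ K)
    (hkK : ∀ i ∈ S, k i ≤ K) (T : ℕ) {i : α} (hi : i ∈ S) :
    ∑ t ∈ Finset.Icc 1 T, expLoss S k s (1 / invBestRate K (minLossOn S s t)) t ≤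
      totalLoss s T i + 2 * √(2 * K * totalLoss s T i) + 2 * √(totalLoss s T i) +
        16 * K * Real.log (2 + totalLoss s T i) := by
  have hl0 := totalLoss_nonneg hs T i
  rcases Nat.eq_zero_or_pos T with rfl | hT
  · have : 0 ≤ Real.log (2 + totalLoss s 0 i) := Real.log_nonneg (by linarith)
    rw [Finset.Icc_eq_empty (by norm_num), Finset.sum_empty]
    positivity
  refine (sum_expLoss_bestRate_aux hk hs hK hkK ⟨i, hi⟩ hT).trans ?_
  have h1 : minLossOn S s (T + 1) ≤ totalLoss s T i := minLossOn_le hs (T + 1) hi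
  have h2 : minLossOn S s T ≤ totalLoss s T i := (minLossOn_le_succ ⟨i, hi⟩ hs hT).trans h1
  have h3 : 0 ≤ minLossOn S s (T + 1) := minLossOn_nonneg hs _
  set l := totalLoss s T i
  have h4 : invBestRate K (minLossOn S s T) ≤ invBestRate K l := invBestRate_mono hK h2
  -- Replacing the maximum by a sum isolates one `√(2 K l)`; `h6` supplies the second one of the
  -- leading term.
  have h5 : K * invBestRate K l ≤ √2 * K + √(2 * K * l) := by
    have e : K * (√2 * √(l / K)) = √(2 * K * l) := by
      rw [show 2 * K * l = K ^ 2 * (2 * (l / K)) by field_simp, Real.sqrt_mul (sq_nonneg K),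
        Real.sqrt_sq (by linarith), Real.sqrt_mul zero_le_two]
    have h : max 1 √(l / K) ≤ 1 + √(l / K) :=
      max_le (by linarith [Real.sqrt_nonneg (l / K)]) (by linarith)
    calc K * invBestRate K l ≤ K * (√2 * (1 + √(l / K))) := by unfold invBestRate; gcongr
      _ = √2 * K + K * (√2 * √(l / K)) := by ring
      _ = _ := by rw [e]
  have h6 : √(2 * (K + 1)) * √l ≤ √(2 * K * l) + √2 * √l := by
    rw [mul_add, mul_one]
    calc √(2 * K + 2) * √l ≤ (√(2 * K) + √2) * √l := by
          gcongr; exact sqrt_add_le_add (by positivity) zero_le_two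
      _ = _ := by rw [add_mul, ← Real.sqrt_mul (by positivity)]
  have h7 : invBestRate K l ≤ 2 + l := by
    have h : √(l / K) ≤ √l := by
      gcongr; exact div_le_self hl0 hK
    have h8 : √2 * √l ≤ 2 + l := by
      rw [← Real.sqrt_mul zero_le_two]
      refine Real.sqrt_le_iff.2 ⟨by linarith, by nlinarith⟩
    have h9 : √2 ≤ 2 := by rw [Real.sqrt_le_left two_pos.le]; norm_num
    rw [invBestRate, mul_max_of_nonneg _ _ (Real.sqrt_nonneg 2), mul_one]
    refine max_le (by linarith) (le_trans ?_ h8)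
    gcongr
  have h8 : Real.log (invBestRate K (minLossOn S s T)) ≤ Real.log (2 + l) :=
    Real.log_le_log invBestRate_pos (h4.trans h7)
  have h9 : Real.log (minLossOn S s (T + 1) + 1) ≤ Real.log (2 + l) :=
    Real.log_le_log (by linarith) (by linarith)
  have h10 : 1 / 2 ≤ Real.log (2 + l) := by
    have := Real.log_two_gt_d9
    have : Real.log 2 ≤ Real.log (2 + l) := Real.log_le_log two_pos (by linarith)
    linarith
  have h11 : √2 ≤ 3 / 2 := by rw [Real.sqrt_le_left (by norm_num)]; norm_num
  have h12 : K * invBestRate K (minLossOn S s T) ≤ K * invBestRate K l := by gcongr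
  have h13 : √(2 * (K + 1)) * √(minLossOn S s (T + 1)) ≤ √(2 * (K + 1)) * √l := by gcongr
  have h14 : (K + 1) * Real.log (minLossOn S s (T + 1) + 1) ≤ 2 * K * Real.log (2 + l) := by
    calc _ ≤ (K + 1) * Real.log (2 + l) := by gcongr
      _ ≤ _ := by
        have : 0 ≤ Real.log (2 + l) := by linarith
        gcongr; linarith
  have h15 : 2 * K * Real.log (invBestRate K (minLossOn S s T)) ≤ 2 * K * Real.log (2 + l) := by
    gcongr
  have h16 : √2 * K ≤ 3 / 2 * K := by gcongr
  have h17 : √2 * √l ≤ 3 / 2 * √l := by gcongr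
  have h18 : K * (1 / 2) ≤ K * Real.log (2 + l) := by gcongr
  have h19 := Real.sqrt_nonneg l
  linarith

end Generic

/-! ### FPL with a rate trading off complexity and past loss. -/

section Generic

variable {α : Type*} {S : Set α} {k : α → ℝ} {s : ℕ → α → ℝ}

/-- The inverse of a learning rate based on a best trade-off of complexity and past loss. -/
noncomputable def invTradeoffRate (S : Set α) (k : α → ℝ) (s : ℕ → α → ℝ) (t : ℕ) : ℝ :=
  ⨅ i : S, (k i + √(k i ^ 2 + 2 * pastLoss s t i + 2))

lemma sqrt_two_le_tradeoff (hk0 : ∀ i ∈ S, 0 ≤ k i)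
    (hs : ∀ t, 1 ≤ t → ∀ i, 0 ≤ s t i ∧ s t i ≤ 1) (t : ℕ) (i : S) :
    √2 ≤ k i + √(k i ^ 2 + 2 * pastLoss s t i + 2) := by
  have h1 := hk0 i i.2
  have h2 := pastLoss_nonneg (fun t ht i => (hs t ht i).1) t (i : α)
  have : √2 ≤ √(k i ^ 2 + 2 * pastLoss s t i + 2) := by
    gcongr; nlinarith [sq_nonneg (k i)]
  linarith

lemma invTradeoffRate_le (hk0 : ∀ i ∈ S, 0 ≤ k i)
    (hs : ∀ t, 1 ≤ t → ∀ i, 0 ≤ s t i ∧ s t i ≤ 1) (t : ℕ) {i : α} (hi : i ∈ S) :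
    invTradeoffRate S k s t ≤ k i + √(k i ^ 2 + 2 * pastLoss s t i + 2) :=
  ciInf_le (f := fun i : S => k i + √(k i ^ 2 + 2 * pastLoss s t i + 2))
    ⟨√2, by rintro _ ⟨i, rfl⟩; exact sqrt_two_le_tradeoff hk0 hs t i⟩ ⟨i, hi⟩

lemma sqrt_two_le_invTradeoffRate (hS : S.Nonempty) (hk0 : ∀ i ∈ S, 0 ≤ k i)
    (hs : ∀ t, 1 ≤ t → ∀ i, 0 ≤ s t i ∧ s t i ≤ 1) (t : ℕ) : √2 ≤ invTradeoffRate S k s t := by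
  have := hS.to_subtype
  exact le_ciInf (sqrt_two_le_tradeoff hk0 hs t)

lemma invTradeoffRate_pos (hS : S.Nonempty) (hk0 : ∀ i ∈ S, 0 ≤ k i)
    (hs : ∀ t, 1 ≤ t → ∀ i, 0 ≤ s t i ∧ s t i ≤ 1) (t : ℕ) : 0 < invTradeoffRate S k s t :=
  (Real.sqrt_pos.2 two_pos).trans_le (sqrt_two_le_invTradeoffRate hS hk0 hs t)

lemma invTradeoffRate_le_succ (hS : S.Nonempty) (hk0 : ∀ i ∈ S, 0 ≤ k i)
    (hs : ∀ t, 1 ≤ t → ∀ i, 0 ≤ s t i ∧ s t i ≤ 1) {t : ℕ} (ht : 1 ≤ t) :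
    invTradeoffRate S k s t ≤ invTradeoffRate S k s (t + 1) := by
  have := hS.to_subtype
  refine le_ciInf fun i => (invTradeoffRate_le hk0 hs t i.2).trans ?_
  rw [pastLoss_succ s ht]
  have := (hs t ht i).1
  gcongr
  linarith

variable [Nonempty α] [Countable α]

/-- FPL with a learning rate based on the best trade-off of complexity and past loss. -/
lemma sum_expLoss_tradeoff_le (hk : ∑' i : S, ENNReal.ofReal (Real.exp (-k i)) ≤ 1)
    (hk0 : ∀ i ∈ S, 0 ≤ k i) (hs : ∀ t, 1 ≤ t → ∀ i, 0 ≤ s t i ∧ s t i ≤ 1) (T : ℕ) {i : α}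
    (hi : i ∈ S) :
    ∑ t ∈ Finset.Icc 1 T, expLoss S k s (1 / invTradeoffRate S k s t) t ≤
      totalLoss s T i + √2 * (k i + 2) * √(totalLoss s T i + 1) + (√2 * (k i + 2)) ^ 2 := by
  have hl0 := totalLoss_nonneg hs T i
  have hki := hk0 i hi
  rcases Nat.eq_zero_or_pos T with rfl | hT
  · rw [Finset.Icc_eq_empty (by norm_num), Finset.sum_empty]
    positivity
  have hS : S.Nonempty := ⟨i, hi⟩
  have hk' := ne_top_of_le_ne_top ENNReal.one_ne_top hk
  set D := invTradeoffRate S k s with hDdef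
  have hD (t : ℕ) : 0 < D t := invTradeoffRate_pos hS hk0 hs t
  have hD2 (t : ℕ) : √2 ≤ D t := sqrt_two_le_invTradeoffRate hS hk0 hs t
  set r : ℕ → ℝ := fun t => infeasibleLoss S k s (1 / D t) t
  have hr0 (t : ℕ) (ht : 1 ≤ t) : 0 ≤ r t := infeasibleLoss_nonneg hs _ ht
  have hr1 (t : ℕ) (ht : 1 ≤ t) : r t ≤ 1 := infeasibleLoss_le_one hs _ ht
  have hsum0 (t : ℕ) : 0 ≤ ∑ τ ∈ Finset.Icc 1 t, r τ :=
    Finset.sum_nonneg fun τ hτ => hr0 τ (Finset.mem_Icc.1 hτ).1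
  have hR (t : ℕ) (ht : 1 ≤ t) {j : α} (hj : j ∈ S) :
      ∑ τ ∈ Finset.Icc 1 t, r τ ≤ totalLoss s t j + k j * D t := by
    have h := sum_infeasibleLoss_le hk hs (fun t _ => one_div_pos.2 (hD t))
      (fun t ht => one_div_le_one_div_of_le (hD t) (invTradeoffRate_le_succ hS hk0 hs ht)) ht hj
    rwa [div_div_eq_mul_div, div_one] at h
  -- `k j + √(k j ^ 2 + 2 l + 2)` is the positive root of `x ^ 2 = 2 (k j * x + l + 1)`. As `D t ≤
  -- x` and `∑ r ≤ l + k j * D t`, this gives `x ^ 2 ≥ 2 (∑ r + 1)`: the rate is self-confident with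
  -- respect to the infeasible loss.
  have hDr (t : ℕ) : √2 * √(∑ τ ∈ Finset.Icc 1 t, r τ + 1) ≤ D (t + 1) := by
    rcases Nat.eq_zero_or_pos t with rfl | ht
    · simpa using hD2 1
    have := hS.to_subtype
    refine le_ciInf fun j => ?_
    have h1 := hk0 j j.2
    have h2 := totalLoss_nonneg hs t (j : α)
    rw [pastLoss_add_one, ← Real.sqrt_mul zero_le_two]
    refine Real.sqrt_le_iff.2 ⟨by positivity, ?_⟩
    have h3 := hR t ht j.2
    have h4 : D t ≤ k j + √(k j ^ 2 + 2 * totalLoss s t j + 2) :=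
      (invTradeoffRate_le_succ hS hk0 hs ht).trans (invTradeoffRate_le hk0 hs (t + 1) j.2)
    have h5 := Real.sq_sqrt (show 0 ≤ k j ^ 2 + 2 * totalLoss s t j + 2 by positivity)
    have h6 := mul_le_mul_of_nonneg_left h4 h1
    nlinarith
  have hL : ∀ t ∈ Finset.Icc 1 T, expLoss S k s (1 / D t) t ≤
      r t + √2 * (r t / √(∑ τ ∈ Finset.Icc 1 (t - 1), r τ + 1)) := by
    intro t ht
    have ht := (Finset.mem_Icc.1 ht).1
    have h1 := expLoss_le_infeasibleLoss hS hk' hs (one_div_pos.2 (hD t)) ht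
    have h0 : 0 < 1 / D t := one_div_pos.2 (hD t)
    have h1' : 1 / D t ≤ 1 := by
      rw [div_le_one (hD t)]; exact (Real.one_le_sqrt.2 one_le_two).trans (hD2 t)
    have h2 := exp_le_one_add_add_sq h0.le h1'
    have h3 : 1 / D t ≤ √2 / 2 * (1 / √(∑ τ ∈ Finset.Icc 1 (t - 1), r τ + 1)) := by
      have h := hDr (t - 1)
      rw [Nat.sub_add_cancel ht] at h
      have hp : 0 < √(∑ τ ∈ Finset.Icc 1 (t - 1), r τ + 1) :=
        Real.sqrt_pos.2 (by linarith [hsum0 (t - 1)])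
      have e : √2 / 2 * (1 / √(∑ τ ∈ Finset.Icc 1 (t - 1), r τ + 1)) =
          1 / (√2 * √(∑ τ ∈ Finset.Icc 1 (t - 1), r τ + 1)) := by
        have := Real.sq_sqrt (zero_le_two (α := ℝ))
        field_simp
        linarith
      rw [e]
      exact one_div_le_one_div_of_le (by positivity) h
    have h4 : Real.exp (1 / D t) ≤ 1 + 2 * (1 / D t) := by nlinarith
    calc expLoss S k s (1 / D t) t ≤ Real.exp (1 / D t) * r t := h1
      _ ≤ (1 + 2 * (√2 / 2 * (1 / √(∑ τ ∈ Finset.Icc 1 (t - 1), r τ + 1)))) * r t := by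
          have := hr0 t ht
          gcongr
          linarith
      _ = _ := by ring
  have hsum := Finset.sum_le_sum hL
  rw [Finset.sum_add_distrib, ← Finset.mul_sum] at hsum
  have h1 := mul_le_mul_of_nonneg_left
    (sum_div_sqrt_le (fun t ht => ⟨hr0 t ht, hr1 t ht⟩) T) (Real.sqrt_nonneg 2)
  set l := totalLoss s T i
  set X := ∑ t ∈ Finset.Icc 1 T, r t
  have h2q := Real.sq_sqrt (zero_le_two (α := ℝ))
  -- The bound `hR` with `D T ≤ 2 k i + √2 √(l + 1)` inserted.
  have hX : X ≤ l + 2 * k i ^ 2 + √2 * k i * √(l + 1) := by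
    have h2 := hR T hT hi
    have h3 : D T ≤ k i + √(k i ^ 2 + 2 * l + 2) :=
      (invTradeoffRate_le_succ hS hk0 hs hT).trans (invTradeoffRate_le hk0 hs (T + 1) hi)
    have h4 : √(k i ^ 2 + 2 * l + 2) ≤ k i + √2 * √(l + 1) := by
      rw [add_assoc, show 2 * l + 2 = 2 * (l + 1) by ring]
      refine (sqrt_add_le_add (by positivity) (by positivity)).trans ?_
      rw [Real.sqrt_sq hki, Real.sqrt_mul zero_le_two]
    have h5 := mul_le_mul_of_nonneg_left (h3.trans (add_le_add_right h4 _)) hki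
    linarith
  have hsX : √X ≤ √(l + 1) + √2 * k i := by
    refine Real.sqrt_le_iff.2 ⟨by positivity, ?_⟩
    have := Real.sq_sqrt (show 0 ≤ l + 1 by linarith)
    have : 0 ≤ √2 * k i * √(l + 1) := by positivity
    nlinarith
  have h3 : √2 * (2 * √X) ≤ 2 * √2 * √(l + 1) + 4 * k i := by
    calc √2 * (2 * √X) ≤ √2 * (2 * (√(l + 1) + √2 * k i)) := by gcongr
      _ = 2 * √2 * √(l + 1) + 2 * √2 ^ 2 * k i := by ring
      _ = _ := by rw [h2q]; ring
  rw [mul_pow, h2q]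
  nlinarith

end Generic

/-! ### Kraft's inequality for the complexity classes. -/

section Classes

variable {ι : Type u} {k : ι → ℝ}

lemma tsum_complexityClass_le (hk : Summable fun i => Real.exp (-k i))
    (hk1 : ∑' i, Real.exp (-k i) ≤ 1) (S : Set ι) :
    ∑' i : S, ENNReal.ofReal (Real.exp (-k i)) ≤ 1 := by
  refine (ENNReal.tsum_comp_le_tsum_of_injective Subtype.val_injective
    fun i => ENNReal.ofReal (Real.exp (-k i))).trans ?_
  rw [← ENNReal.ofReal_tsum_of_nonneg (fun i => (Real.exp_pos _).le) hk]
  simpa using hk1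

lemma one_le_of_mem_metaClass (hk0 : ∀ i, 0 < k i) {K : ℕ} (hK : K ∈ metaClass k) : 1 ≤ K := by
  obtain ⟨i, hi⟩ := hK
  have : 0 < ⌈k i⌉₊ := Nat.ceil_pos.2 (hk0 i)
  rw [show ⌈k i⌉₊ = K from hi] at this
  exact this

lemma ceil_mem_metaClass (i : ι) : ⌈k i⌉₊ ∈ metaClass k := ⟨i, rfl⟩

lemma metaClass_nonempty [Nonempty ι] : (metaClass k).Nonempty :=
  ⟨_, ceil_mem_metaClass (Classical.arbitrary ι)⟩

lemma le_of_mem_complexityClass {K : ℕ} {i : ι} (hi : i ∈ complexityClass k K) : k i ≤ K := by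
  rw [← show ⌈k i⌉₊ = K from hi]; exact Nat.le_ceil _

lemma exp_neg_metaComplexity {K : ℕ} (hK : 1 ≤ K) :
    Real.exp (-metaComplexity K) = Real.exp (-(1 / 2)) * (1 / (K : ℝ) ^ 2) := by
  have hK' : (0 : ℝ) < K := by exact_mod_cast hK
  rw [metaComplexity, neg_add, Real.exp_add, Real.exp_neg (2 * Real.log K),
    show 2 * Real.log K = Real.log K + Real.log K by ring, Real.exp_add, Real.exp_log hK']
  rw [one_div ((K : ℝ) ^ 2), sq]

/-- The summands are `exp (-1/2) / K ^ 2`, and `π ^ 2 / 6 < 1.645 < √e`. The margin is narrow: this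
is what the `1/2` in the meta complexity is for. -/
lemma tsum_metaClass_le (hk0 : ∀ i, 0 < k i) :
    ∑' K : metaClass k, ENNReal.ofReal (Real.exp (-metaComplexity K)) ≤ 1 := by
  calc ∑' K : metaClass k, ENNReal.ofReal (Real.exp (-metaComplexity K))
      = ∑' K : metaClass k, ENNReal.ofReal (Real.exp (-(1 / 2)) * (1 / ((K : ℕ) : ℝ) ^ 2)) :=
        tsum_congr fun K => by rw [exp_neg_metaComplexity (one_le_of_mem_metaClass hk0 K.2)]
    -- The added term `K = 0` is harmless, since `1 / 0 = 0`.
    _ ≤ ∑' K : ℕ, ENNReal.ofReal (Real.exp (-(1 / 2)) * (1 / (K : ℝ) ^ 2)) :=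
        ENNReal.tsum_comp_le_tsum_of_injective Subtype.val_injective
          fun K : ℕ => ENNReal.ofReal (Real.exp (-(1 / 2)) * (1 / (K : ℝ) ^ 2))
    _ = ENNReal.ofReal (Real.exp (-(1 / 2)) * (Real.pi ^ 2 / 6)) := by
        have h := hasSum_zeta_two.mul_left (Real.exp (-(1 / 2)))
        rw [← ENNReal.ofReal_tsum_of_nonneg (fun K => by positivity) h.summable, h.tsum_eq]
    _ ≤ 1 := by
        rw [ENNReal.ofReal_le_one, Real.exp_neg, inv_mul_le_one₀ (Real.exp_pos _)]
        have h1 : Real.exp (1 / 2) ^ 2 = Real.exp 1 := by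
          rw [← Real.exp_nat_mul]; norm_num
        have h2 := Real.exp_one_gt_d9
        have h3 := Real.pi_lt_d4
        have h4 := Real.pi_pos
        have h5 : Real.pi ^ 2 / 6 ≤ 1.645 := by nlinarith
        have h6 : 1.645 ≤ Real.exp (1 / 2) := by
          by_contra h
          push Not at h
          nlinarith [Real.exp_pos (1 / 2 : ℝ)]
        linarith

lemma metaComplexity_nonneg {K : ℕ} (hK : 1 ≤ K) : 0 ≤ metaComplexity K := by
  have : 0 ≤ Real.log (K : ℝ) := Real.log_nonneg (by exact_mod_cast hK)
  unfold metaComplexity; positivity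

end Classes

/-! ### Joint measurability and Fubini for the two layers. -/

section Hierarchy

variable {ι : Type u} [Nonempty ι] {k : ι → ℝ} {s : ℕ → ι → ℝ} {η : ℕ → ℕ → ℝ}

lemma metaLoss_mem (hs : ∀ t, 1 ≤ t → ∀ i, 0 ≤ s t i ∧ s t i ≤ 1) (q : ι → ℝ) (t : ℕ)
    (ht : 1 ≤ t) (K : ℕ) : 0 ≤ metaLoss k s η q t K ∧ metaLoss k s η q t K ≤ 1 :=
  hs t ht _

variable [Countable ι]

lemma aestronglyMeasurable_metaLoss
    (hk : ∀ S : Set ι, ∑' i : S, ENNReal.ofReal (Real.exp (-k i)) ≤ 1)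
    (hs : ∀ t, 1 ≤ t → ∀ i, 0 ≤ s t i ∧ s t i ≤ 1)
    (hη : ∀ K ∈ metaClass k, ∀ t, 1 ≤ t → 0 < η K t) {t : ℕ} (ht : 1 ≤ t) (K : ℕ) :
    AEStronglyMeasurable (fun q => metaLoss k s η q t K) (perturbation ι) := by
  by_cases hK : K ∈ metaClass k
  · exact aestronglyMeasurable_fplLoss hK (ne_top_of_le_ne_top ENNReal.one_ne_top (hk _)) hs
      (hη K hK t ht) t t
  -- On an empty class the choice is a default value that does not depend on `q`.
  · have h0 : complexityClass k K = ∅ := Set.not_nonempty_iff_eq_empty.1 hK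
    have : (fun q => metaLoss k s η q t K) = fun _ => metaLoss k s η 0 t K := by
      funext q
      simp [metaLoss, subChoice, fplChoice, argminOn, h0]
    rw [this]
    exact aestronglyMeasurable_const

lemma integrable_metaLoss (hk : ∀ S : Set ι, ∑' i : S, ENNReal.ofReal (Real.exp (-k i)) ≤ 1)
    (hs : ∀ t, 1 ≤ t → ∀ i, 0 ≤ s t i ∧ s t i ≤ 1)
    (hη : ∀ K ∈ metaClass k, ∀ t, 1 ≤ t → 0 < η K t) {t : ℕ} (ht : 1 ≤ t) (K : ℕ) :
    Integrable (fun q => metaLoss k s η q t K) (perturbation ι) := by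
  refine .of_bound (aestronglyMeasurable_metaLoss hk hs hη ht K) 1 (.of_forall fun q => ?_)
  rw [Real.norm_eq_abs, abs_le]
  have := metaLoss_mem (k := k) (η := η) hs q t ht K
  constructor <;> linarith

/-- Joint measurability of the loss of the hierarchical FPL. -/
lemma aestronglyMeasurable_hierChoice (hk0 : ∀ i, 0 < k i)
    (hk : ∀ S : Set ι, ∑' i : S, ENNReal.ofReal (Real.exp (-k i)) ≤ 1)
    (hs : ∀ t, 1 ≤ t → ∀ i, 0 ≤ s t i ∧ s t i ≤ 1)
    (hη : ∀ K ∈ metaClass k, ∀ t, 1 ≤ t → 0 < η K t) {t : ℕ} (ht : 1 ≤ t)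
    {h : (ι → ℝ) → ℝ} (hh : ∀ q, 0 < h q) (hhm : AEMeasurable h (perturbation ι)) :
    AEStronglyMeasurable (fun p : (ι → ℝ) × (ℕ → ℝ) => metaLoss k s η p.1 t
      (fplChoice (metaClass k) metaComplexity (metaLoss k s η p.1) (h p.1) t p.2))
      ((perturbation ι).prod (perturbation ℕ)) := by
  have hm := nullMeasurableSet_fplChoice_prod (μ := perturbation ι) (S := metaClass k)
    (k := metaComplexity) metaClass_nonempty
    (ne_top_of_le_ne_top ENNReal.one_ne_top (tsum_metaClass_le hk0))
    (s := fun q => metaLoss k s η q) (fun q t ht K => (metaLoss_mem hs q t ht K).1)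
    (fun t ht K => (aestronglyMeasurable_metaLoss hk hs hη ht K).aemeasurable) hh hhm t
  exact (aemeasurable_apply_choice hm (g := fun K p => metaLoss k s η p.1 t K) fun K =>
    (aestronglyMeasurable_metaLoss hk hs hη ht K).aemeasurable.comp_fst).aestronglyMeasurable

lemma integrable_hierChoice (hk0 : ∀ i, 0 < k i)
    (hk : ∀ S : Set ι, ∑' i : S, ENNReal.ofReal (Real.exp (-k i)) ≤ 1)
    (hs : ∀ t, 1 ≤ t → ∀ i, 0 ≤ s t i ∧ s t i ≤ 1)
    (hη : ∀ K ∈ metaClass k, ∀ t, 1 ≤ t → 0 < η K t) {t : ℕ} (ht : 1 ≤ t)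
    {h : (ι → ℝ) → ℝ} (hh : ∀ q, 0 < h q) (hhm : AEMeasurable h (perturbation ι)) :
    Integrable (fun p : (ι → ℝ) × (ℕ → ℝ) => metaLoss k s η p.1 t
      (fplChoice (metaClass k) metaComplexity (metaLoss k s η p.1) (h p.1) t p.2))
      ((perturbation ι).prod (perturbation ℕ)) := by
  refine .of_bound (aestronglyMeasurable_hierChoice hk0 hk hs hη ht hh hhm) 1
    (.of_forall fun p => ?_)
  rw [Real.norm_eq_abs, abs_le]
  have := metaLoss_mem (k := k) (η := η) hs p.1 t ht
    (fplChoice (metaClass k) metaComplexity (metaLoss k s η p.1) (h p.1) t p.2)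
  constructor <;> linarith

/-- The expected loss of the hierarchical FPL at time `t`, given the perturbation `q`. -/
noncomputable def condLoss (k : ι → ℝ) (s : ℕ → ι → ℝ) (η : ℕ → ℕ → ℝ) (η' : ℝ) (t : ℕ)
    (q : ι → ℝ) : ℝ :=
  expLoss (metaClass k) metaComplexity (metaLoss k s η q) η' t

lemma integrable_condLoss (hk0 : ∀ i, 0 < k i)
    (hk : ∀ S : Set ι, ∑' i : S, ENNReal.ofReal (Real.exp (-k i)) ≤ 1)
    (hs : ∀ t, 1 ≤ t → ∀ i, 0 ≤ s t i ∧ s t i ≤ 1)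
    (hη : ∀ K ∈ metaClass k, ∀ t, 1 ≤ t → 0 < η K t) {t : ℕ} (ht : 1 ≤ t)
    {h : (ι → ℝ) → ℝ} (hh : ∀ q, 0 < h q) (hhm : AEMeasurable h (perturbation ι)) :
    Integrable (fun q => condLoss k s η (h q) t q) (perturbation ι) :=
  (integrable_hierChoice hk0 hk hs hη ht hh hhm).integral_prod_left

lemma integral_hierChoice (hk0 : ∀ i, 0 < k i)
    (hk : ∀ S : Set ι, ∑' i : S, ENNReal.ofReal (Real.exp (-k i)) ≤ 1)
    (hs : ∀ t, 1 ≤ t → ∀ i, 0 ≤ s t i ∧ s t i ≤ 1)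
    (hη : ∀ K ∈ metaClass k, ∀ t, 1 ≤ t → 0 < η K t) {t : ℕ} (ht : 1 ≤ t)
    {η' : ℕ → (ι → ℝ) → ℝ} (hh : ∀ q, 0 < η' t q) (hhm : AEMeasurable (η' t) (perturbation ι)) :
    ∫ p, s t (hierChoice k s η η' t p.1 p.2) ∂(hierPerturbation ι) =
      ∫ q, condLoss k s η (η' t q) t q ∂(perturbation ι) :=
  integral_prod _ (integrable_hierChoice hk0 hk hs hη ht hh hhm)

/-- To bound the expected loss of the hierarchical FPL, one may first take the expectation over the
perturbations of the meta experts. -/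
lemma expectedLossLE_of_integral_le (hk0 : ∀ i, 0 < k i)
    (hk : ∀ S : Set ι, ∑' i : S, ENNReal.ofReal (Real.exp (-k i)) ≤ 1)
    (hs : ∀ t, 1 ≤ t → ∀ i, 0 ≤ s t i ∧ s t i ≤ 1)
    (hη : ∀ K ∈ metaClass k, ∀ t, 1 ≤ t → 0 < η K t)
    {η' : ℕ → (ι → ℝ) → ℝ} (hh : ∀ t, 1 ≤ t → ∀ q, 0 < η' t q)
    (hhm : ∀ t, 1 ≤ t → AEMeasurable (η' t) (perturbation ι)) {T : ℕ} {B : ℝ}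
    (hB : ∫ q, ∑ t ∈ Finset.Icc 1 T, condLoss k s η (η' t q) t q ∂(perturbation ι) ≤ B) :
    ExpectedLossLE k s η η' T B := by
  have hint : ∀ t ∈ Finset.Icc 1 T, Integrable
      (fun p : (ι → ℝ) × (ℕ → ℝ) => s t (hierChoice k s η η' t p.1 p.2)) (hierPerturbation ι) :=
    fun t ht => integrable_hierChoice hk0 hk hs hη (Finset.mem_Icc.1 ht).1
      (hh t (Finset.mem_Icc.1 ht).1) (hhm t (Finset.mem_Icc.1 ht).1)
  refine ⟨integrable_finsetSum _ hint, le_trans (le_of_eq ?_) hB⟩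
  unfold hierLoss
  rw [integral_finsetSum _ hint, integral_finsetSum _ fun t ht =>
    integrable_condLoss hk0 hk hs hη (Finset.mem_Icc.1 ht).1 (hh t (Finset.mem_Icc.1 ht).1)
      (hhm t (Finset.mem_Icc.1 ht).1)]
  exact Finset.sum_congr rfl fun t ht => integral_hierChoice hk0 hk hs hη (Finset.mem_Icc.1 ht).1
    (hh t (Finset.mem_Icc.1 ht).1) (hhm t (Finset.mem_Icc.1 ht).1)

end Hierarchy

/-! ### Jensen's inequality and the final arithmetic. -/

section Bounds

/-- Integration of a bound concave in the comparator. -/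
lemma integral_le_add_mul_sqrt {Ω : Type*} [MeasurableSpace Ω] {μ : Measure Ω}
    [IsProbabilityMeasure μ] {X Y : Ω → ℝ} {c : ℝ} (hc : 0 ≤ c) (hY : Integrable Y μ)
    (hX : Integrable X μ) (hX0 : ∀ ω, 0 ≤ X ω)
    (h : ∀ ω, Y ω ≤ X ω + c * √(X ω + 1) + c ^ 2) :
    ∫ ω, Y ω ∂μ ≤ ∫ ω, X ω ∂μ + c * √(∫ ω, X ω ∂μ + 1) + c ^ 2 := by
  set a := √(∫ ω, X ω ∂μ + 1) with ha
  have hE : 0 ≤ ∫ ω, X ω ∂μ := integral_nonneg hX0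
  have ha0 : 0 < a := Real.sqrt_pos.2 (by linarith)
  have ha2 : a ^ 2 = ∫ ω, X ω ∂μ + 1 := Real.sq_sqrt (by linarith)
  have hpt (ω : Ω) : Y ω ≤ (1 + c / (2 * a)) * X ω + (c / (2 * a) + c * a / 2 + c ^ 2) := by
    -- The tangent line of the square root at `a ^ 2 = E X + 1`; its integral is exact there.
    have h1 : √(X ω + 1) ≤ (X ω + 1) / (2 * a) + a / 2 := by
      have h2 := Real.sq_sqrt (show 0 ≤ X ω + 1 by linarith [hX0 ω])
      have h3 : (X ω + 1) / (2 * a) + a / 2 - √(X ω + 1) = (√(X ω + 1) - a) ^ 2 / (2 * a) := by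
        field_simp
        linear_combination -h2
      have : 0 ≤ (√(X ω + 1) - a) ^ 2 / (2 * a) := by positivity
      linarith
    have h2 := mul_le_mul_of_nonneg_left h1 hc
    have e : c * ((X ω + 1) / (2 * a) + a / 2) = c / (2 * a) * X ω + (c / (2 * a) + c * a / 2) := by
      ring
    linarith [h ω]
  calc ∫ ω, Y ω ∂μ
      ≤ ∫ ω, ((1 + c / (2 * a)) * X ω + (c / (2 * a) + c * a / 2 + c ^ 2)) ∂μ :=
        integral_mono hY ((hX.const_mul _).add (integrable_const _)) hpt
    _ = (1 + c / (2 * a)) * ∫ ω, X ω ∂μ + (c / (2 * a) + c * a / 2 + c ^ 2) := by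
        rw [integral_add (hX.const_mul _) (integrable_const _), integral_const_mul]
        simp
    _ = ∫ ω, X ω ∂μ + c / (2 * a) * (∫ ω, X ω ∂μ + 1) + c * a / 2 + c ^ 2 := by ring
    _ = _ := by
        rw [← ha2]; field_simp; ring

lemma log_le_two_mul_sqrt_sub {x : ℝ} (hx : 1 ≤ x) : Real.log x ≤ 2 * √x - 2 := by
  have h := Real.log_le_sub_one_of_pos (x := √x) (Real.sqrt_pos.2 (by linarith))
  rw [Real.log_sqrt (by linarith)] at h
  linarith

lemma half_le_log_two_add {x : ℝ} (hx : 0 ≤ x) : 1 / 2 ≤ Real.log (2 + x) := by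
  have := Real.log_two_gt_d9
  have : Real.log 2 ≤ Real.log (2 + x) := Real.log_le_log two_pos (by linarith)
  linarith

lemma sqrt_two_le : √2 ≤ 3 / 2 := by
  rw [Real.sqrt_le_left (by norm_num)]; norm_num

lemma metaComplexity_le {k : ℝ} {K : ℕ} (hK : 1 ≤ K) (hKk : (K : ℝ) ≤ k + 1) :
    metaComplexity K ≤ 1 / 2 + 2 * Real.log (2 + k) := by
  have : Real.log (K : ℝ) ≤ Real.log (2 + k) :=
    Real.log_le_log (by exact_mod_cast hK) (by linarith)
  unfold metaComplexity
  linarith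

/-- The price of rounding `k` up to an integer is a multiple of `√x`, by subadditivity of the root.
-/
lemma sqrt_mul_add_one_le {k K x : ℝ} (hk : 0 < k) (hKk : K ≤ k + 1) (hx : 0 ≤ x) :
    2 * √(2 * K * x) ≤ 2 * √(2 * x * k) + 3 * √x := by
  have h1 : √(2 * K * x) ≤ √(2 * x * k) + √(2 * x) := by
    refine le_trans (Real.sqrt_le_sqrt ?_) (sqrt_add_le_add (by positivity) (by positivity))
    nlinarith
  have h2 : √(2 * x) ≤ 3 / 2 * √x := by
    rw [Real.sqrt_mul zero_le_two]
    gcongr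
    exact sqrt_two_le
  linarith

/-- The relative error `log (2 + k) / √k` amounts to an additive error of order `log (2 + k) * √x`;
all terms of that order are absorbed through this identity. -/
lemma mul_one_add_log_div_sqrt {k x : ℝ} (hk : 0 < k) (hx : 0 ≤ x) {A : ℝ} :
    2 * √(2 * x * k) * (1 + A * (Real.log (2 + k) / √k)) =
      2 * √(2 * x * k) + 2 * √2 * A * (Real.log (2 + k) * √x) := by
  have : 0 < √k := Real.sqrt_pos.2 hk
  rw [Real.sqrt_mul (by positivity), Real.sqrt_mul zero_le_two]
  field_simp

/-- Both the rounding error and the meta regret are `O(log (2 + k)) * √T`, because `log (2 + k) ≥ 1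
/ 2`. -/
lemma time_bound {T k K l B : ℝ} {s : ℝ} (hT : 0 ≤ T) (hk : 0 < k) (hKk : K ≤ k + 1) {c : ℝ}
    (hc : c ≤ 1 / 2 + 2 * Real.log (2 + k)) (hl : l ≤ s + 2 * √(2 * K * T))
    (hB : B ≤ l + (c + 2) * √T) :
    B ≤ s + 2 * √(2 * T * k) * (1 + 200 * (Real.log (2 + k) / √k)) := by
  have h1 := sqrt_mul_add_one_le hk hKk hT
  have h2 := half_le_log_two_add hk.le
  rw [mul_one_add_log_div_sqrt hk hT]
  have h3 : (c + 2) * √T ≤ (1 / 2 + 2 * Real.log (2 + k) + 2) * √T := by gcongr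
  have h4 : 1 * √T ≤ 2 * Real.log (2 + k) * √T := by gcongr; linarith
  have h5 : 1 * (Real.log (2 + k) * √T) ≤ √2 * (Real.log (2 + k) * √T) := by
    gcongr; exact Real.one_le_sqrt.2 one_le_two
  have h6 : 0 ≤ Real.log (2 + k) * √T := by positivity
  nlinarith

/-- The meta coefficient `c` is estimated twice: as `O(log (2 + k))` where it multiplies `√s`, and
as `O(√K)` in the lower-order terms, so that these stay `O(K * lam)`. The parameter `lam` is `1` for
self-confident rates and `log (2 + s)` for best-loss rates. -/
lemma loss_bound {s k l B lam c : ℝ} {K : ℕ} (hs : 0 ≤ s) (hk : 0 < k) (hK : 1 ≤ K)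
    (hKk : (K : ℝ) ≤ k + 1) (hlam : 1 / 2 ≤ lam)
    (hl : l ≤ s + 2 * √(2 * K * s) + 2 * √s + 16 * K * lam)
    (hc : c = √2 * (metaComplexity K + 2)) (hB : B ≤ l + c * √(l + 1) + c ^ 2) :
    B ≤ s + 2 * √(2 * s * k) * (1 + 200 * (Real.log (2 + k) / √k)) + 200 * ((1 + k) * lam) := by
  have hK1 : (1 : ℝ) ≤ K := by exact_mod_cast hK
  have hc0 : 0 ≤ c := by
    rw [hc]; have := metaComplexity_nonneg hK; positivity
  have hL := half_le_log_two_add hk.le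
  have hcL : c ≤ 4 + 3 * Real.log (2 + k) := by
    have := metaComplexity_le hK hKk
    have h1 : √2 * (metaComplexity K + 2) ≤ 3 / 2 * (metaComplexity K + 2) := by
      have := metaComplexity_nonneg hK
      gcongr; exact sqrt_two_le
    linarith
  have hcK : c ≤ 6 * √(K : ℝ) := by
    have h1 := log_le_two_mul_sqrt_sub hK1
    have h2 : √2 * (metaComplexity K + 2) ≤ 3 / 2 * (4 * √(K : ℝ)) := by
      have := metaComplexity_nonneg hK
      gcongr
      · exact sqrt_two_le
      · unfold metaComplexity; linarith
    linarith
  have hKs := Real.sq_sqrt (show (0 : ℝ) ≤ K by linarith)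
  have hss := Real.sq_sqrt hs
  have hlam0 : 0 < lam := by linarith
  have hK0 := Real.sqrt_nonneg (K : ℝ)
  have hls := Real.sq_sqrt hlam0.le
  have hlam1 : 7 / 10 ≤ √lam := Real.le_sqrt_of_sq_le (by linarith)
  have hK1' : 1 ≤ √(K : ℝ) := Real.one_le_sqrt.2 hK1
  have hs0 := Real.sqrt_nonneg s
  have hKlam : 7 / 10 ≤ √(K : ℝ) * √lam := by nlinarith
  have h1 : √(l + 1) ≤ √s + 5 * (√(K : ℝ) * √lam) := by
    refine Real.sqrt_le_iff.2 ⟨by positivity, ?_⟩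
    have h2 : √(2 * K * s) ≤ 3 / 2 * (√(K : ℝ) * √s) := by
      rw [Real.sqrt_mul (by positivity), Real.sqrt_mul zero_le_two, mul_assoc]
      gcongr; exact sqrt_two_le
    have h3 : √(K : ℝ) * √s ≤ 10 / 7 * (√s * (√(K : ℝ) * √lam)) := by
      have : √(K : ℝ) * √s * (7 / 10) ≤ √(K : ℝ) * √s * √lam := by gcongr
      linarith
    have h4 : √s ≤ 10 / 7 * (√s * (√(K : ℝ) * √lam)) := by
      have : √s * (7 / 10) ≤ √s * (√(K : ℝ) * √lam) := by gcongr
      linarith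
    have h5 : 1 / 2 ≤ K * lam := by nlinarith
    have h6 : (√(K : ℝ) * √lam) ^ 2 = K * lam := by rw [mul_pow, hKs, hls]
    nlinarith
  have h2 : c * √(l + 1) ≤ c * √s + 45 * (K * lam) := by
    have h3 : √lam ≤ 3 / 2 * lam := by nlinarith
    calc c * √(l + 1) ≤ c * (√s + 5 * (√(K : ℝ) * √lam)) := by gcongr
      _ = c * √s + 5 * (c * (√(K : ℝ) * √lam)) := by ring
      _ ≤ c * √s + 5 * (6 * √(K : ℝ) * (√(K : ℝ) * (3 / 2 * lam))) := by gcongr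
      _ = c * √s + 45 * (√(K : ℝ) ^ 2 * lam) := by ring
      _ = _ := by rw [hKs]
  have h3 : c ^ 2 ≤ 72 * (K * lam) := by
    calc c ^ 2 ≤ (6 * √(K : ℝ)) ^ 2 := by gcongr
      _ = 36 * (K : ℝ) := by rw [mul_pow, hKs]; norm_num
      _ ≤ _ := by nlinarith
  have h4 := sqrt_mul_add_one_le hk hKk hs
  have h5 : K * lam ≤ (1 + k) * lam := by gcongr; linarith
  have h6 : c * √s ≤ (4 + 3 * Real.log (2 + k)) * √s := by gcongr
  have h7 : 1 * √s ≤ 2 * Real.log (2 + k) * √s := by gcongr; linarith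
  have h8 : 1 * (Real.log (2 + k) * √s) ≤ √2 * (Real.log (2 + k) * √s) := by
    gcongr; exact Real.one_le_sqrt.2 one_le_two
  have h9 : 0 ≤ Real.log (2 + k) * √s := by positivity
  have h10 : 0 ≤ (1 + k) * lam := by positivity
  rw [mul_one_add_log_div_sqrt hk hs]
  nlinarith

end Bounds

/-! ### The hierarchical FPL under each choice of rates. -/

section Hierarchy

variable {ι : Type u} [Nonempty ι] {k : ι → ℝ} {s : ℕ → ι → ℝ} {η : ℕ → ℕ → ℝ}

variable [Countable ι]

lemma integrable_totalLoss_metaLoss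
    (hk : ∀ S : Set ι, ∑' i : S, ENNReal.ofReal (Real.exp (-k i)) ≤ 1)
    (hs : ∀ t, 1 ≤ t → ∀ i, 0 ≤ s t i ∧ s t i ≤ 1)
    (hη : ∀ K ∈ metaClass k, ∀ t, 1 ≤ t → 0 < η K t) (T K : ℕ) :
    Integrable (fun q => totalLoss (metaLoss k s η q) T K) (perturbation ι) :=
  integrable_finsetSum _ fun _ ht => integrable_metaLoss hk hs hη (Finset.mem_Icc.1 ht).1 K

lemma integral_totalLoss_metaLoss
    (hk : ∀ S : Set ι, ∑' i : S, ENNReal.ofReal (Real.exp (-k i)) ≤ 1)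
    (hs : ∀ t, 1 ≤ t → ∀ i, 0 ≤ s t i ∧ s t i ≤ 1)
    (hη : ∀ K ∈ metaClass k, ∀ t, 1 ≤ t → 0 < η K t) (T K : ℕ) :
    ∫ q, totalLoss (metaLoss k s η q) T K ∂(perturbation ι) =
      ∑ t ∈ Finset.Icc 1 T, expLoss (complexityClass k K) k s (η K t) t :=
  integral_finsetSum _ fun _ ht => integrable_metaLoss hk hs hη (Finset.mem_Icc.1 ht).1 K

lemma integrable_sum_condLoss (hk0 : ∀ i, 0 < k i)
    (hk : ∀ S : Set ι, ∑' i : S, ENNReal.ofReal (Real.exp (-k i)) ≤ 1)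
    (hs : ∀ t, 1 ≤ t → ∀ i, 0 ≤ s t i ∧ s t i ≤ 1)
    (hη : ∀ K ∈ metaClass k, ∀ t, 1 ≤ t → 0 < η K t)
    {η' : ℕ → (ι → ℝ) → ℝ} (hh : ∀ t, 1 ≤ t → ∀ q, 0 < η' t q)
    (hhm : ∀ t, 1 ≤ t → AEMeasurable (η' t) (perturbation ι)) (T : ℕ) :
    Integrable (fun q => ∑ t ∈ Finset.Icc 1 T, condLoss k s η (η' t q) t q) (perturbation ι) :=
  integrable_finsetSum _ fun t ht => integrable_condLoss hk0 hk hs hη (Finset.mem_Icc.1 ht).1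
    (hh t (Finset.mem_Icc.1 ht).1) (hhm t (Finset.mem_Icc.1 ht).1)

/-- A bound for the meta experts given their losses carries over to the hierarchical FPL. -/
lemma expectedLossLE_of_condLoss_le (hk0 : ∀ i, 0 < k i)
    (hk : ∀ S : Set ι, ∑' i : S, ENNReal.ofReal (Real.exp (-k i)) ≤ 1)
    (hs : ∀ t, 1 ≤ t → ∀ i, 0 ≤ s t i ∧ s t i ≤ 1)
    (hη : ∀ K ∈ metaClass k, ∀ t, 1 ≤ t → 0 < η K t)
    {η' : ℕ → (ι → ℝ) → ℝ} (hh : ∀ t, 1 ≤ t → ∀ q, 0 < η' t q)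
    (hhm : ∀ t, 1 ≤ t → AEMeasurable (η' t) (perturbation ι)) {T : ℕ} {i : ι} {lam : ℝ}
    (hlam : 1 / 2 ≤ lam)
    (hl : ∑ t ∈ Finset.Icc 1 T, expLoss (complexityClass k ⌈k i⌉₊) k s (η ⌈k i⌉₊ t) t ≤
      totalLoss s T i + 2 * √(2 * (⌈k i⌉₊ : ℝ) * totalLoss s T i) + 2 * √(totalLoss s T i) +
        16 * (⌈k i⌉₊ : ℝ) * lam)
    (hc : ∀ q, ∑ t ∈ Finset.Icc 1 T, condLoss k s η (η' t q) t q ≤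
      totalLoss (metaLoss k s η q) T ⌈k i⌉₊ + √2 * (metaComplexity ⌈k i⌉₊ + 2) *
        √(totalLoss (metaLoss k s η q) T ⌈k i⌉₊ + 1) + (√2 * (metaComplexity ⌈k i⌉₊ + 2)) ^ 2) :
    ExpectedLossLE k s η η' T (totalLoss s T i
      + 2 * √(2 * totalLoss s T i * k i) * (1 + 200 * (Real.log (2 + k i) / √(k i)))
      + 200 * ((1 + k i) * lam)) := by
  have hK := one_le_of_mem_metaClass hk0 (ceil_mem_metaClass i)
  have h0 := metaComplexity_nonneg hK
  have h := integral_le_add_mul_sqrt (by positivity)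
    (integrable_sum_condLoss hk0 hk hs hη hh hhm T)
    (integrable_totalLoss_metaLoss hk hs hη T ⌈k i⌉₊)
    (fun q => totalLoss_nonneg (metaLoss_mem hs q) T _) hc
  rw [integral_totalLoss_metaLoss hk hs hη] at h
  exact expectedLossLE_of_integral_le hk0 hk hs hη hh hhm
    (loss_bound (totalLoss_nonneg hs T i) (hk0 i) hK (Nat.ceil_lt_add_one (hk0 i).le).le hlam
      hl rfl h)

lemma timeRate_eq (K t : ℕ) : timeRate K t = √((K : ℝ) / 2) / √(t : ℝ) := by
  rw [timeRate, ← div_div, Real.sqrt_div (by positivity)]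

/-- `a = √(K / 2)` balances `K / a` against `2 a`; both equal `√(2 K)`. This is the source of the
leading constant. -/
lemma div_sqrt_half_le {κ K : ℝ} (hK : 0 < K) (hκ : κ ≤ K) :
    κ / √(K / 2) + 2 * √(K / 2) ≤ 2 * √(2 * K) := by
  have h1 : √(2 * K) = 2 * √(K / 2) := by
    rw [show 2 * K = 2 ^ 2 * (K / 2) by ring, Real.sqrt_mul (by positivity),
      Real.sqrt_sq zero_le_two]
  have h2 : κ / √(K / 2) ≤ 2 * √(K / 2) := by
    rw [div_le_iff₀ (by positivity), mul_assoc, Real.mul_self_sqrt (by positivity)]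
    linarith
  linarith

/-- Rates depending only on time. -/
theorem expectedLossLE_timeRate (hk0 : ∀ i, 0 < k i)
    (hk : ∀ S : Set ι, ∑' i : S, ENNReal.ofReal (Real.exp (-k i)) ≤ 1)
    (hs : ∀ t, 1 ≤ t → ∀ i, 0 ≤ s t i ∧ s t i ≤ 1) (T : ℕ) (i : ι) :
    ExpectedLossLE k s timeRate metaTimeRate T (totalLoss s T i
      + 2 * √(2 * T * k i) * (1 + 200 * (Real.log (2 + k i) / √(k i)))) := by
  have hη : ∀ K ∈ metaClass k, ∀ t, 1 ≤ t → 0 < timeRate K t := fun K hK t ht => by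
    have hK := one_le_of_mem_metaClass hk0 hK
    exact Real.sqrt_pos.2 (by positivity)
  have hh : ∀ t, 1 ≤ t → ∀ q : ι → ℝ, 0 < metaTimeRate t q := fun t ht q =>
    one_div_pos.2 (Real.sqrt_pos.2 (by exact_mod_cast ht))
  have hhm : ∀ t, 1 ≤ t → AEMeasurable (metaTimeRate t) (perturbation ι) :=
    fun t _ => aemeasurable_const
  have hmem := ceil_mem_metaClass (k := k) i
  have hK := one_le_of_mem_metaClass hk0 hmem
  have hK0 : (0 : ℝ) < ⌈k i⌉₊ := by exact_mod_cast hK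
  refine expectedLossLE_of_integral_le hk0 hk hs hη hh hhm ?_
  have hl := sum_expLoss_time_le (hk (complexityClass k ⌈k i⌉₊)) hs
    (a := √((⌈k i⌉₊ : ℝ) / 2)) (Real.sqrt_pos.2 (by positivity)) T (i := i) rfl
  simp_rw [← timeRate_eq] at hl
  have hX := integrable_totalLoss_metaLoss hk hs hη T ⌈k i⌉₊
  have hB : ∫ q, ∑ t ∈ Finset.Icc 1 T, condLoss k s timeRate (metaTimeRate t q) t q
      ∂(perturbation ι) ≤
      ∑ t ∈ Finset.Icc 1 T, expLoss (complexityClass k ⌈k i⌉₊) k s (timeRate ⌈k i⌉₊ t) t +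
        (metaComplexity ⌈k i⌉₊ + 2) * √(T : ℝ) := by
    rw [← integral_totalLoss_metaLoss hk hs hη]
    calc _ ≤ ∫ q, (totalLoss (metaLoss k s timeRate q) T ⌈k i⌉₊ +
          (metaComplexity ⌈k i⌉₊ + 2) * √(T : ℝ)) ∂(perturbation ι) := by
          refine integral_mono (integrable_sum_condLoss hk0 hk hs hη hh hhm T)
            (hX.add (integrable_const _)) fun q => ?_
          have := sum_expLoss_time_le (tsum_metaClass_le hk0)
            (metaLoss_mem (k := k) (η := timeRate) hs q) one_pos T hmem
          simp only [div_one, mul_one] at this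
          exact this
      _ = _ := by
          rw [integral_add hX (integrable_const _)]
          simp
  refine time_bound T.cast_nonneg (hk0 i) (Nat.ceil_lt_add_one (hk0 i).le).le
    (metaComplexity_le hK (Nat.ceil_lt_add_one (hk0 i).le).le) (hl.trans ?_) hB
  rw [Real.sqrt_mul (by positivity), ← mul_assoc]
  gcongr
  exact div_sqrt_half_le hK0 (Nat.le_ceil _)

lemma selfConfidentRate_fun_eq (K : ℝ) (l : ℝ) (hK : 0 ≤ K) :
    √(K / (2 * (l + 1))) = √(K / 2) / √(l + 1) := by
  rw [← div_div, Real.sqrt_div (by positivity)]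

lemma metaRate_fun_eq (l : ℝ) : 1 / √(2 * (l + 1)) = (1 / √2) / √(l + 1) := by
  rw [Real.sqrt_mul zero_le_two, div_div]

omit [Countable ι] in
lemma selfConfidentRate_pos (hk0 : ∀ i, 0 < k i) (hs : ∀ t, 1 ≤ t → ∀ i, 0 ≤ s t i ∧ s t i ≤ 1) :
    ∀ K ∈ metaClass k, ∀ t, 1 ≤ t → 0 < selfConfidentRate k s K t := fun K hK t _ => by
  have hK := one_le_of_mem_metaClass hk0 hK
  have := selfConfidentLoss_nonneg (S := complexityClass k K) (k := k) hs
    (fun l => √((K : ℝ) / (2 * (l + 1)))) (t - 1)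
  exact Real.sqrt_pos.2 (by positivity)

lemma sum_expLoss_selfConfidentRate_le (hk0 : ∀ i, 0 < k i)
    (hk : ∀ S : Set ι, ∑' i : S, ENNReal.ofReal (Real.exp (-k i)) ≤ 1)
    (hs : ∀ t, 1 ≤ t → ∀ i, 0 ≤ s t i ∧ s t i ≤ 1) (T : ℕ) (i : ι) :
    ∑ t ∈ Finset.Icc 1 T,
        expLoss (complexityClass k ⌈k i⌉₊) k s (selfConfidentRate k s ⌈k i⌉₊ t) t ≤
      totalLoss s T i + 2 * √(2 * (⌈k i⌉₊ : ℝ) * totalLoss s T i) + 2 * √(totalLoss s T i) +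
        16 * (⌈k i⌉₊ : ℝ) * 1 := by
  have hK := one_le_of_mem_metaClass hk0 (ceil_mem_metaClass i)
  set K := ⌈k i⌉₊
  have hK1 : (1 : ℝ) ≤ K := by exact_mod_cast hK
  have hl0 := totalLoss_nonneg hs T i
  have h := selfConfidentLoss_le (hk (complexityClass k K)) (fun i _ => (hk0 i).le) hs
    (a := √((K : ℝ) / 2)) (Real.sqrt_pos.2 (by positivity))
    (rate := fun l => √((K : ℝ) / (2 * (l + 1))))
    (fun l _ => selfConfidentRate_fun_eq K l (by positivity)) T (i := i) rfl
  rw [selfConfidentLoss_eq_sum] at h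
  refine le_trans h ?_
  have h1 : k i / √((K : ℝ) / 2) + 2 * √((K : ℝ) / 2) ≤ 2 * √(2 * (K : ℝ)) :=
    div_sqrt_half_le (by positivity) (Nat.le_ceil _)
  have h0 : 0 ≤ k i / √((K : ℝ) / 2) + 2 * √((K : ℝ) / 2) := by have := hk0 i; positivity
  set l := totalLoss s T i
  have h2 : √(l + 1) ≤ √l + 1 := by
    simpa using sqrt_add_le_add hl0 zero_le_one
  have h3 : √(2 * (K : ℝ)) * √l = √(2 * K * l) := (Real.sqrt_mul (by positivity) _).symm
  have h4 : √(2 * (K : ℝ)) ≤ 2 * K := Real.sqrt_le_iff.2 ⟨by positivity, by nlinarith⟩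
  have h5 := Real.sqrt_nonneg l
  have h6 := Real.sq_sqrt (show (0 : ℝ) ≤ 2 * K by positivity)
  calc l + (k i / √((K : ℝ) / 2) + 2 * √((K : ℝ) / 2)) * √(l + 1) +
        (k i / √((K : ℝ) / 2) + 2 * √((K : ℝ) / 2)) ^ 2
      ≤ l + (2 * √(2 * (K : ℝ))) * (√l + 1) + (2 * √(2 * (K : ℝ))) ^ 2 := by gcongr
    _ = l + 2 * (√(2 * (K : ℝ)) * √l) + 2 * √(2 * (K : ℝ)) + 4 * √(2 * (K : ℝ)) ^ 2 := by ring
    _ ≤ _ := by rw [h3, h6]; linarith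

/-- The left side is `√2 * (κ + 1)`; it is weakened to the coefficient of `sum_expLoss_tradeoff_le`,
so that `loss_bound` serves all loss-based meta rates. -/
lemma metaCoefficient_le {κ : ℝ} : κ / (1 / √2) + 2 * (1 / √2) ≤ √2 * (κ + 2) := by
  have h1 : 1 / √2 = √2 / 2 := by
    have := Real.sq_sqrt (zero_le_two (α := ℝ))
    field_simp; linarith
  rw [div_div_eq_mul_div, div_one, h1]
  linarith [Real.sqrt_nonneg 2]

lemma aemeasurable_meta_selfConfidentLoss (hk0 : ∀ i, 0 < k i)
    (hk : ∀ S : Set ι, ∑' i : S, ENNReal.ofReal (Real.exp (-k i)) ≤ 1)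
    (hs : ∀ t, 1 ≤ t → ∀ i, 0 ≤ s t i ∧ s t i ≤ 1)
    (hη : ∀ K ∈ metaClass k, ∀ t, 1 ≤ t → 0 < η K t) {rate : ℝ → ℝ} (hr : Measurable rate)
    (hr0 : ∀ l, 0 ≤ l → 0 < rate l) (t : ℕ) :
    AEMeasurable (fun q => selfConfidentLoss (metaClass k) metaComplexity (metaLoss k s η q) rate t)
      (perturbation ι) := by
  induction t with
  | zero => exact aemeasurable_const
  | succ t ih =>
    exact ih.add (integrable_condLoss hk0 hk hs hη (show 1 ≤ t + 1 by omega)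
      (fun q => hr0 _ (selfConfidentLoss_nonneg (metaLoss_mem hs q) rate t))
      (hr.comp_aemeasurable ih)).aestronglyMeasurable.aemeasurable

lemma mul_sqrt_add_sq_mono {a b x : ℝ} (ha : 0 ≤ a) (hab : a ≤ b) :
    x + a * √(x + 1) + a ^ 2 ≤ x + b * √(x + 1) + b ^ 2 := by
  gcongr

/-- Self-confident rates, with the expected loss of the meta FPL given the losses of the meta
experts. -/
theorem expectedLossLE_metaSelfConfidentRate (hk0 : ∀ i, 0 < k i)
    (hk : ∀ S : Set ι, ∑' i : S, ENNReal.ofReal (Real.exp (-k i)) ≤ 1)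
    (hs : ∀ t, 1 ≤ t → ∀ i, 0 ≤ s t i ∧ s t i ≤ 1) (T : ℕ) (i : ι) :
    ExpectedLossLE k s (selfConfidentRate k s)
      (metaSelfConfidentRate k s (selfConfidentRate k s)) T (totalLoss s T i
      + 2 * √(2 * totalLoss s T i * k i) * (1 + 200 * (Real.log (2 + k i) / √(k i)))
      + 200 * ((1 + k i) * 1)) := by
  have hη := selfConfidentRate_pos hk0 hs
  have hm := fun t => aemeasurable_meta_selfConfidentLoss hk0 hk hs hη
    (rate := fun l => 1 / √(2 * (l + 1))) (by fun_prop) (fun l hl => by positivity) t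
  refine expectedLossLE_of_condLoss_le hk0 hk hs hη (fun t _ q => ?_) (fun t _ => ?_)
    (by norm_num) (sum_expLoss_selfConfidentRate_le hk0 hk hs T i) fun q => ?_
  · have := selfConfidentLoss_nonneg (S := metaClass k) (k := metaComplexity)
      (metaLoss_mem (k := k) (η := selfConfidentRate k s) hs q)
      (fun l => 1 / √(2 * (l + 1))) (t - 1)
    unfold metaSelfConfidentRate
    positivity
  · exact (show Measurable fun l : ℝ => 1 / √(2 * (l + 1)) by fun_prop).comp_aemeasurable
      (hm (t - 1))
  · have hmem := ceil_mem_metaClass (k := k) i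
    have hK0 := metaComplexity_nonneg (one_le_of_mem_metaClass hk0 hmem)
    have h := selfConfidentLoss_le (tsum_metaClass_le hk0)
      (fun K hK => metaComplexity_nonneg (one_le_of_mem_metaClass hk0 hK))
      (metaLoss_mem (k := k) (η := selfConfidentRate k s) hs q) (a := 1 / √2) (by positivity)
      (rate := fun l => 1 / √(2 * (l + 1))) (fun l _ => metaRate_fun_eq l) T hmem
    rw [selfConfidentLoss_eq_sum] at h
    exact h.trans (mul_sqrt_add_sq_mono (by positivity) metaCoefficient_le)

omit [Countable ι] in
lemma hierSelfConfidentLoss_le_succ (hs : ∀ t, 1 ≤ t → ∀ i, 0 ≤ s t i ∧ s t i ≤ 1) (t : ℕ) :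
    hierSelfConfidentLoss k s η t ≤ hierSelfConfidentLoss k s η (t + 1) := by
  rw [hierSelfConfidentLoss]
  linarith [integral_nonneg (μ := hierPerturbation ι) (f := fun p => s (t + 1) (hierChoice k s η
    (fun _ _ => 1 / √(2 * (hierSelfConfidentLoss k s η t + 1))) (t + 1) p.1 p.2))
    fun p => (hs (t + 1) (by omega) _).1]

omit [Countable ι] in
lemma hierSelfConfidentLoss_nonneg (hs : ∀ t, 1 ≤ t → ∀ i, 0 ≤ s t i ∧ s t i ≤ 1) (t : ℕ) :
    0 ≤ hierSelfConfidentLoss k s η t := by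
  induction t with
  | zero => exact le_rfl
  | succ t ih => exact ih.trans (hierSelfConfidentLoss_le_succ hs t)

omit [Countable ι] in
lemma metaTotalSelfConfidentRate_pos (hs : ∀ t, 1 ≤ t → ∀ i, 0 ≤ s t i ∧ s t i ≤ 1) (t : ℕ)
    (q : ι → ℝ) : 0 < metaTotalSelfConfidentRate k s η t q := by
  have := hierSelfConfidentLoss_nonneg (k := k) (η := η) hs (t - 1)
  unfold metaTotalSelfConfidentRate
  positivity

lemma hierSelfConfidentLoss_eq_sum (hk0 : ∀ i, 0 < k i)
    (hk : ∀ S : Set ι, ∑' i : S, ENNReal.ofReal (Real.exp (-k i)) ≤ 1)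
    (hs : ∀ t, 1 ≤ t → ∀ i, 0 ≤ s t i ∧ s t i ≤ 1)
    (hη : ∀ K ∈ metaClass k, ∀ t, 1 ≤ t → 0 < η K t) (T : ℕ) :
    hierSelfConfidentLoss k s η T = ∑ t ∈ Finset.Icc 1 T,
      ∫ q, condLoss k s η (metaTotalSelfConfidentRate k s η t q) t q ∂(perturbation ι) := by
  induction T with
  | zero => simp [hierSelfConfidentLoss]
  | succ T ih =>
    rw [Finset.sum_Icc_succ_top (by omega), ← ih, hierSelfConfidentLoss,
      ← integral_hierChoice hk0 hk hs hη (show 1 ≤ T + 1 by omega)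
        (η' := metaTotalSelfConfidentRate k s η)
        (fun q => metaTotalSelfConfidentRate_pos hs (T + 1) q) aemeasurable_const]
    rfl

/-- Self-confident rates, with the expected loss of the hierarchical FPL over all perturbations. -/
theorem expectedLossLE_metaTotalSelfConfidentRate (hk0 : ∀ i, 0 < k i)
    (hk : ∀ S : Set ι, ∑' i : S, ENNReal.ofReal (Real.exp (-k i)) ≤ 1)
    (hs : ∀ t, 1 ≤ t → ∀ i, 0 ≤ s t i ∧ s t i ≤ 1) (T : ℕ) (i : ι) :
    ExpectedLossLE k s (selfConfidentRate k s)
      (metaTotalSelfConfidentRate k s (selfConfidentRate k s)) T (totalLoss s T i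
      + 2 * √(2 * totalLoss s T i * k i) * (1 + 200 * (Real.log (2 + k i) / √(k i)))
      + 200 * ((1 + k i) * 1)) := by
  have hη := selfConfidentRate_pos hk0 hs
  have hmem := ceil_mem_metaClass (k := k) i
  have hK := one_le_of_mem_metaClass hk0 hmem
  have hK0 := metaComplexity_nonneg hK
  set η := selfConfidentRate k s
  set η' : ℕ → (ι → ℝ) → ℝ := metaTotalSelfConfidentRate k s η with hη'
  set H := hierSelfConfidentLoss k s η with hH
  have hH0 (t : ℕ) : 0 ≤ H t := hierSelfConfidentLoss_nonneg hs t
  have hHs (t : ℕ) : H t ≤ H (t + 1) := hierSelfConfidentLoss_le_succ hs t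
  have hrate (t : ℕ) (q : ι → ℝ) : η' t q = (1 / √2) / √(H (t - 1) + 1) := metaRate_fun_eq _
  have hh : ∀ t, 1 ≤ t → ∀ q, 0 < η' t q := fun t _ q => metaTotalSelfConfidentRate_pos hs t q
  have hhm : ∀ t, 1 ≤ t → AEMeasurable (η' t) (perturbation ι) := fun _ _ => aemeasurable_const
  have hci (t : ℕ) (ht : 1 ≤ t) :
      Integrable (fun q => condLoss k s η (η' t q) t q) (perturbation ι) :=
    integrable_condLoss hk0 hk hs hη ht (hh t ht) (hhm t ht)
  have hsum := integrable_sum_condLoss hk0 hk hs hη hh hhm T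
  have hHT : ∫ q, ∑ t ∈ Finset.Icc 1 T, condLoss k s η (η' t q) t q ∂(perturbation ι) = H T := by
    rw [integral_finsetSum _ fun t ht => hci t (Finset.mem_Icc.1 ht).1, hH,
      hierSelfConfidentLoss_eq_sum hk0 hk hs hη]
  set X := ∑ t ∈ Finset.Icc 1 T, expLoss (complexityClass k ⌈k i⌉₊) k s (η ⌈k i⌉₊ t) t with hXdef
  have hX0 : 0 ≤ X :=
    Finset.sum_nonneg fun t ht => expLoss_nonneg hs _ (Finset.mem_Icc.1 ht).1
  set c := √2 * (metaComplexity ⌈k i⌉₊ + 2) with hc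
  have hc0 : 0 ≤ c := by positivity
  -- The rate depends on the averaged loss `H`, so the recursion does not close for fixed `q`: the
  -- regret inequality is averaged first, and the quadratic inequality is then solved for `H T`.
  have key : H T ≤ X + c * √(X + 1) + c ^ 2 := by
    rcases Nat.eq_zero_or_pos T with rfl | hT
    · have : 0 ≤ X + c * √(X + 1) + c ^ 2 := by positivity
      simpa [hH, hierSelfConfidentLoss] using this
    have hXi := integrable_totalLoss_metaLoss hk hs hη T ⌈k i⌉₊
    -- The rate is constant in `q`; evaluating it at the dummy argument `0` lets it leave the
    -- integral.
    have hwi : Integrable (fun q => ∑ t ∈ Finset.Icc 1 T,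
        η' t 0 * condLoss k s η (η' t q) t q) (perturbation ι) :=
      integrable_finsetSum _ fun t ht => (hci t (Finset.mem_Icc.1 ht).1).const_mul _
    have hpt (q : ι → ℝ) : ∑ t ∈ Finset.Icc 1 T, condLoss k s η (η' t q) t q ≤
        totalLoss (metaLoss k s η q) T ⌈k i⌉₊ + metaComplexity ⌈k i⌉₊ / η' T q +
          ∑ t ∈ Finset.Icc 1 T, η' t 0 * condLoss k s η (η' t q) t q :=
      sum_expLoss_le (η := fun t => η' t q) (tsum_metaClass_le hk0)
        (metaLoss_mem (k := k) (η := η) hs q) (fun t ht => hh t ht q)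
        (fun t ht => by
          obtain ⟨n, rfl⟩ : ∃ n, t = n + 1 := ⟨t - 1, by omega⟩
          rw [hrate, hrate]
          exact div_sqrt_antitone (by positivity) (hH0 _) (hHs n)) hT hmem
    have hXc : Integrable (fun q => totalLoss (metaLoss k s η q) T ⌈k i⌉₊ +
        metaComplexity ⌈k i⌉₊ / η' T 0) (perturbation ι) := hXi.add (integrable_const _)
    have h1 : _ ≤ ∫ q, (totalLoss (metaLoss k s η q) T ⌈k i⌉₊ + metaComplexity ⌈k i⌉₊ / η' T 0 +
        ∑ t ∈ Finset.Icc 1 T, η' t 0 * condLoss k s η (η' t q) t q) ∂(perturbation ι) :=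
      integral_mono hsum (hXc.add hwi) hpt
    rw [hHT] at h1
    have h2 : ∫ q, (totalLoss (metaLoss k s η q) T ⌈k i⌉₊ + metaComplexity ⌈k i⌉₊ / η' T 0 +
        ∑ t ∈ Finset.Icc 1 T, η' t 0 * condLoss k s η (η' t q) t q) ∂(perturbation ι) =
        X + metaComplexity ⌈k i⌉₊ / η' T 0 + ∑ t ∈ Finset.Icc 1 T, η' t 0 *
          ∫ q, condLoss k s η (η' t q) t q ∂(perturbation ι) := by
      rw [integral_add hXc hwi, integral_add hXi (integrable_const _),
        integral_totalLoss_metaLoss hk hs hη, integral_finsetSum _ fun t ht =>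
          (hci t (Finset.mem_Icc.1 ht).1).const_mul (η' t 0), integral_const]
      congr 1
      · simp [hXdef]
      · exact Finset.sum_congr rfl fun t _ => integral_const_mul _ _
    rw [h2] at h1
    have h3 : ∑ t ∈ Finset.Icc 1 T, η' t 0 * ∫ q, condLoss k s η (η' t q) t q ∂(perturbation ι) ≤
        1 / √2 * (2 * √(H T)) := by
      have h4 := sum_div_sqrt_le
        (x := fun t => ∫ q, condLoss k s η (η' t q) t q ∂(perturbation ι))
        (fun t ht => ⟨integral_nonneg fun q => expLoss_nonneg (metaLoss_mem hs q) _ ht,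
          integral_le_one_of_le (fun q => expLoss_nonneg (metaLoss_mem hs q) _ ht)
            fun q => expLoss_le_one (metaLoss_mem hs q) _ ht⟩) T
      simp only [hη', ← hierSelfConfidentLoss_eq_sum hk0 hk hs hη] at h4
      refine le_trans (le_of_eq ?_) (mul_le_mul_of_nonneg_left h4 (by positivity))
      rw [Finset.mul_sum]
      refine Finset.sum_congr rfl fun t ht => ?_
      rw [hrate t]; ring
    have h5 : metaComplexity ⌈k i⌉₊ / η' T 0 ≤ metaComplexity ⌈k i⌉₊ / (1 / √2) * √(H T + 1) := by
      obtain ⟨n, rfl⟩ : ∃ n, T = n + 1 := ⟨T - 1, by omega⟩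
      rw [hrate, Nat.add_sub_cancel, div_div_eq_mul_div, mul_div_right_comm]
      have := hHs n
      gcongr
    have h6 : √(H T) ≤ √(H T + 1) := by gcongr; linarith
    have h7 : 1 / √2 * (2 * √(H T)) ≤ 2 * (1 / √2) * √(H T + 1) := by
      rw [← mul_assoc, mul_comm (1 / √2)]; gcongr
    have h8 := mul_le_mul_of_nonneg_right (metaCoefficient_le (κ := metaComplexity ⌈k i⌉₊))
      (Real.sqrt_nonneg (H T + 1))
    have h9 : H T + 1 ≤ (X + 1) + c * √(H T + 1) := by
      rw [add_mul] at h8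
      linarith
    have := le_of_le_add_mul_sqrt (by linarith [hH0 T]) (by linarith) hc0 h9
    linarith
  exact expectedLossLE_of_integral_le hk0 hk hs hη hh hhm
    (loss_bound (totalLoss_nonneg hs T i) (hk0 i) hK (Nat.ceil_lt_add_one (hk0 i).le).le
      (by norm_num) (sum_expLoss_selfConfidentRate_le hk0 hk hs T i) rfl (hHT.trans_le key))

omit [Nonempty ι] [Countable ι] in
-- `min 1 √(K / m)` is the inverse of `max 1 √(m / K)`. The latter form needs no convention at `m =
-- 0`, where the root vanishes and the maximum is `1`.
lemma minLossRate_eq (hs : ∀ t, 1 ≤ t → ∀ i, 0 ≤ s t i ∧ s t i ≤ 1) {K : ℕ} (hK : 1 ≤ K) (t : ℕ) :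
    minLossRate k s K t = 1 / invBestRate K (minLossOn (complexityClass k K) s t) := by
  have hm : 0 ≤ minPastLoss k s K t := minLossOn_nonneg hs t
  have hK0 : (0 : ℝ) < K := by exact_mod_cast hK
  rw [show minLossOn (complexityClass k K) s t = minPastLoss k s K t from rfl, minLossRate,
    invBestRate, Real.sqrt_div' _ zero_le_two, Real.sqrt_one, one_div, one_div, mul_inv]
  congr 1
  split_ifs with h
  · simp [h]
  · have hm' : 0 < minPastLoss k s K t := lt_of_le_of_ne hm (Ne.symm h)
    rw [← inv_div (minPastLoss k s K t) (K : ℝ), Real.sqrt_inv]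
    have hp : 0 < √(minPastLoss k s K t / K) := Real.sqrt_pos.2 (by positivity)
    rcases le_total 1 √(minPastLoss k s K t / K) with h1 | h1
    · rw [max_eq_right h1, min_eq_right (inv_le_one_of_one_le₀ h1)]
    · rw [max_eq_left h1, min_eq_left ((one_le_inv₀ hp).2 h1), inv_one]

/-- Rates depending on the best loss so far. -/
theorem expectedLossLE_metaMinLossRate (hk0 : ∀ i, 0 < k i)
    (hk : ∀ S : Set ι, ∑' i : S, ENNReal.ofReal (Real.exp (-k i)) ≤ 1)
    (hs : ∀ t, 1 ≤ t → ∀ i, 0 ≤ s t i ∧ s t i ≤ 1) (T : ℕ) (i : ι) :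
    ExpectedLossLE k s (minLossRate k s) (metaMinLossRate k s (minLossRate k s)) T
      (totalLoss s T i
      + 2 * √(2 * totalLoss s T i * k i) * (1 + 200 * (Real.log (2 + k i) / √(k i)))
      + 200 * ((1 + k i) * Real.log (2 + totalLoss s T i))) := by
  have hη : ∀ K ∈ metaClass k, ∀ t, 1 ≤ t → 0 < minLossRate k s K t := fun K hK t _ => by
    rw [minLossRate_eq hs (one_le_of_mem_metaClass hk0 hK)]
    exact one_div_pos.2 invBestRate_pos
  have hmem := ceil_mem_metaClass (k := k) i
  have hK := one_le_of_mem_metaClass hk0 hmem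
  have hc0 : ∀ K ∈ metaClass k, 0 ≤ metaComplexity K :=
    fun K hK => metaComplexity_nonneg (one_le_of_mem_metaClass hk0 hK)
  refine expectedLossLE_of_condLoss_le hk0 hk hs hη (fun t _ q => ?_) (fun t _ => ?_)
    (half_le_log_two_add (totalLoss_nonneg hs T i)) ?_ fun q => ?_
  · exact one_div_pos.2 (invTradeoffRate_pos ⟨_, hmem⟩ hc0
      (metaLoss_mem (k := k) (η := minLossRate k s) hs q) t)
  · unfold metaMinLossRate
    refine AEMeasurable.const_div (AEMeasurable.iInf fun K => ?_) 1
    have : AEMeasurable (fun q => pastLoss (metaLoss k s (minLossRate k s) q) t (K : ℕ))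
        (perturbation ι) :=
      Finset.aemeasurable_fun_sum _ fun τ hτ =>
        (aestronglyMeasurable_metaLoss hk hs hη (Finset.mem_Ico.1 hτ).1 K).aemeasurable
    fun_prop
  · simp_rw [minLossRate_eq hs hK]
    exact sum_expLoss_bestRate_le (hk _) hs (by exact_mod_cast hK)
      (fun j hj => le_of_mem_complexityClass hj) T rfl
  · exact sum_expLoss_tradeoff_le (tsum_metaClass_le hk0) hc0
      (metaLoss_mem (k := k) (η := minLossRate k s) hs q) T hmem

end Hierarchy

end HFPL

theorem mainTheorem3 :
    ∃ C : ℝ, 0 < C ∧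
      ∀ (ι : Type u) [Countable ι] [Nonempty ι] (k : ι → ℝ) (s : ℕ → ι → ℝ),
        (∀ i, 0 < k i) →
        Summable (fun i => Real.exp (-k i)) →
        ∑' i, Real.exp (-k i) ≤ 1 →
        (∀ t, 1 ≤ t → ∀ i, 0 ≤ s t i ∧ s t i ≤ 1) →
        ∀ (T : ℕ) (i : ι),
          -- (a) rates depending only on time
          HFPL.ExpectedLossLE k s HFPL.timeRate HFPL.metaTimeRate T
            (HFPL.totalLoss s T i
              + 2 * √(2 * T * k i) * (1 + C * (Real.log (2 + k i) / √(k i)))) ∧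
          -- (b) self-confident rates, with the expected loss of the meta FPL taken over its own
          -- perturbation, or over both perturbations
          (HFPL.ExpectedLossLE k s (HFPL.selfConfidentRate k s)
              (HFPL.metaSelfConfidentRate k s (HFPL.selfConfidentRate k s)) T
              (HFPL.totalLoss s T i
                + 2 * √(2 * HFPL.totalLoss s T i * k i)
                  * (1 + C * (Real.log (2 + k i) / √(k i)))
                + C * (1 + k i)) ∧
            HFPL.ExpectedLossLE k s (HFPL.selfConfidentRate k s)
              (HFPL.metaTotalSelfConfidentRate k s (HFPL.selfConfidentRate k s)) T
              (HFPL.totalLoss s T i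
                + 2 * √(2 * HFPL.totalLoss s T i * k i)
                  * (1 + C * (Real.log (2 + k i) / √(k i)))
                + C * (1 + k i))) ∧
          -- (b) rates depending on the best loss so far
          HFPL.ExpectedLossLE k s (HFPL.minLossRate k s)
            (HFPL.metaMinLossRate k s (HFPL.minLossRate k s)) T
            (HFPL.totalLoss s T i
              + 2 * √(2 * HFPL.totalLoss s T i * k i)
                * (1 + C * (Real.log (2 + k i) / √(k i)))
              + C * ((1 + k i) * Real.log (2 + HFPL.totalLoss s T i))) := by
  -- The constant of `time_bound` and `loss_bound`.
  refine ⟨200, by norm_num, ?_⟩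
  intro ι _ _ k s hk0 hsum hk1 hs T i
  have hk := HFPL.tsum_complexityClass_le hsum hk1
  refine ⟨HFPL.expectedLossLE_timeRate hk0 hk hs T i, ⟨?_, ?_⟩,
    HFPL.expectedLossLE_metaMinLossRate hk0 hk hs T i⟩
  · simpa only [mul_one] using HFPL.expectedLossLE_metaSelfConfidentRate hk0 hk hs T i
  · simpa only [mul_one] using HFPL.expectedLossLE_metaTotalSelfConfidentRate hk0 hk hs T i
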